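/- Let $n\ge 1$ and let $M$ be a $(2n+1)$-dimensional smooth manifold with an almost paracontact metric structure $(\varphi,\xi,\eta,g)$: a smooth $(1,1)$-tensor field $\varphi$, a smooth vector field $\xi$, a smooth 1-form $\eta$ and a smooth pseudo-Riemannian metric $g$ such that $$\varphi^2=\mathrm{id}-\eta\otimes\xi,\qquad \eta(\xi)=1,\qquad \varphi\xi=0,\qquad g(\varphi x,\varphi y)=-g(x,y)+\eta(x)\eta(y).$$ Let $\nabla$ be the Levi-Civita connection of $g$, let $F(x,y,z)=g((\nabla_x\varphi)y,z)$, and write $hx=\varphi^2x$. The structure is called *normal* if $N(X,Y)-2\,d\eta(X,Y)\,\xi=0$ for all smooth vector fields $X,Y$, where $$N(X,Y)=\varphi^2[X,Y]+[\varphi X,\varphi Y]-\varphi[\varphi X,Y]-\varphi[X,\varphi Y],\qquad d\eta(X,Y)=\tfrac12\bigl(X\eta(Y)-Y\eta(X)-\eta([X,Y])\bigr).$$ At a point $p$ let $\mathcal F_p$ be the space of trilinear forms $F$ on $T_pM$ with $$F(x,y,z)=-F(x,z,y)=F(x,\varphi y,\varphi z)-\eta(y)F(x,z,\xi)+\eta(z)F(x,y,\xi).$$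 For $F\in\mathcal F_p$ put $\theta_F(z)=g^{ij}F(e_i,e_j,z)$ and $\theta^*_F(z)=g^{ij}F(e_i,\varphi e_j,z)$, where $(e_i)_{i=1}^{2n}$ is a basis of $\ker\eta_p$ and $(g^{ij})$ is the inverse of the matrix $(g(e_i,e_j))$. Define subspaces of $\mathcal F_p$ (all conditions are for all $x,y,z\in T_pM$): - $\mathbb G_1$: $F(x,y,z)=\frac{1}{2(n-1)}\{g(x,\varphi y)\theta_F(\varphi z)-g(x,\varphi z)\theta_F(\varphi y)-g(\varphi x,\varphi y)\theta_F(hz)+g(\varphi x,\varphi z)\theta_F(hy)\}$ if $n\ge2$, and $\mathbb G_1=\{0\}$ if $n=1$; - $\mathbb G_2$: $F(\varphi x,\varphi y,z)=-F(x,y,z)$ and $\theta_F=0$; - $\mathbb G_5$: $F(x,y,z)=\frac{\theta_F(\xi)}{2n}\{\eta(y)g(\varphi x,\varphi z)-\eta(z)g(\varphi x,\varphi y)\}$; - $\mathbb G_6$: $F(x,y,z)=-\frac{\theta^*_F(\xi)}{2n}\{\eta(y)g(x,\varphi z)-\eta(z)g(x,\varphi y)\}$; - $\mathbb G_7$: $F(x,y,z)=-\eta(y)F(x,z,\xi)+\eta(z)F(x,y,\xi)$,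 $F(x,y,\xi)=-F(y,x,\xi)=-F(\varphi x,\varphi y,\xi)$ and $\theta^*_F(\xi)=0$; - $\mathbb G_8$: $F(x,y,z)=-\eta(y)F(x,z,\xi)+\eta(z)F(x,y,\xi)$, $F(x,y,\xi)=F(y,x,\xi)=-F(\varphi x,\varphi y,\xi)$ and $\theta_F(\xi)=0$. For a non-empty set $S\subseteq\{1,2,5,6,7,8\}$ we say that $M$ belongs to $\bigoplus_{i\in S}\mathbb G_i$ if at every point $p\in M$ the sum of the subspaces $\mathbb G_i$, $i\in S$, of $\mathcal F_p$ is direct and contains the tensor $F$ of $M$ at $p$. **Theorem.** $M$ is normal if and only if $M$ belongs to one of the classes $\mathbb G_1,\mathbb G_2,\mathbb G_5,\mathbb G_6,\mathbb G_7,\mathbb G_8$ or to a direct sum of some of them, that is, if and only if there is a non-empty $S\subseteq\{1,2,5,6,7,8\}$ such that $M$ belongs to $\bigoplus_{i\in S}\mathbb G_i$. -/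

import Mathlib

open Bundle Manifold ContDiff

noncomputable section

section PseudoRiemannian

variable {E : Type*} [NormedAddCommGroup E] [NormedSpace ℝ E]
  {H : Type*} [TopologicalSpace H] (I : ModelWithCorners ℝ E H)
  (M : Type*) [TopologicalSpace M] [ChartedSpace H M] [IsManifold I ∞ M]

/-- A smooth pseudo-Riemannian metric on the manifold `M`. -/
structure PseudoRiemannianMetric where
  val (p : M) : TangentSpace I p →L[ℝ] TangentSpace I p →L[ℝ] ℝ
  symm (p : M) (v w : TangentSpace I p) : val p v w = val p w v
  nondegenerate (p : M) (v : TangentSpace I p) (h : ∀ w, val p v w = 0) : v = 0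
  contMDiff : ContMDiff I (I.prod 𝓘(ℝ, E →L[ℝ] E →L[ℝ] ℝ)) ∞
    (fun p ↦ TotalSpace.mk' (E →L[ℝ] E →L[ℝ] ℝ)
      (E := fun p : M ↦ TangentSpace I p →L[ℝ] TangentSpace I p →L[ℝ] ℝ) p (val p))

namespace PseudoRiemannianMetric

variable {I M} (g : PseudoRiemannianMetric I M)

theorem mdifferentiableAt_apply {p : M} {Y Z : Π q : M, TangentSpace I q}
    (hY : MDiffAt (T% Y) p) (hZ : MDiffAt (T% Z) p) :
    MDiffAt (fun q ↦ g.val q (Y q) (Z q)) p := by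
  have : MDifferentiableAt I (I.prod 𝓘(ℝ))
      (fun m ↦ TotalSpace.mk' ℝ (E := Bundle.Trivial M ℝ) m (g.val m (Y m) (Z m))) p := by
    apply MDifferentiableAt.clm_bundle_apply₂ (F₁ := E) (F₂ := E)
    · exact g.contMDiff.mdifferentiableAt (by simp)
    · exact hY
    · exact hZ
  simp only [mdifferentiableAt_totalSpace] at this
  exact this.2

theorem eq_of_val_eq {p : M} {v v' : TangentSpace I p} (h : ∀ w, g.val p v w = g.val p v' w) :
    v = v' := by
  rw [← sub_eq_zero]
  exact g.nondegenerate p _ fun w ↦ by simp [h w]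

theorem mdifferentiableAt_end_apply {φ : Π p : M, TangentSpace I p →L[ℝ] TangentSpace I p}
    (hφ : ContMDiff I (I.prod 𝓘(ℝ, E →L[ℝ] E)) ∞ (fun p ↦ TotalSpace.mk' (E →L[ℝ] E)
      (E := fun p : M ↦ TangentSpace I p →L[ℝ] TangentSpace I p) p (φ p)))
    {p : M} {Y : Π q : M, TangentSpace I q}
    (hY : MDiffAt (T% Y) p) : MDiffAt (T% (fun q ↦ φ q (Y q))) p := by
  apply MDifferentiableAt.clm_bundle_apply (F₁ := E) (F₂ := E)
  · exact hφ.mdifferentiableAt (by simp)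
  · exact hY

variable [FiniteDimensional ℝ E]

/-- The vector that represents a linear functional with respect to the metric. -/
def sharp (p : M) : (TangentSpace I p →L[ℝ] ℝ) →ₗ[ℝ] TangentSpace I p :=
  haveI : FiniteDimensional ℝ (TangentSpace I p) := inferInstanceAs (FiniteDimensional ℝ E)
  haveI : T2Space (TangentSpace I p) := inferInstanceAs (T2Space E)
  (LinearEquiv.ofInjectiveOfFinrankEq (g.val p).toLinearMap
    ((injective_iff_map_eq_zero _).2 fun v hv ↦ g.nondegenerate p v fun w ↦ by
      simpa using congrArg (fun f : TangentSpace I p →L[ℝ] ℝ ↦ f w) hv)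
    (by
      rw [← LinearEquiv.finrank_eq
        (LinearMap.toContinuousLinearMap (𝕜 := ℝ) (E := TangentSpace I p) (F' := ℝ))]
      exact (Subspace.dual_finrank_eq (K := ℝ) (V := TangentSpace I p)).symm)).symm.toLinearMap

theorem val_sharp (p : M) (α : TangentSpace I p →L[ℝ] ℝ) (w : TangentSpace I p) :
    g.val p (g.sharp p α) w = α w := by
  have : FiniteDimensional ℝ (TangentSpace I p) := inferInstanceAs (FiniteDimensional ℝ E)
  have : T2Space (TangentSpace I p) := inferInstanceAs (T2Space E)
  have : (g.val p).toLinearMap (g.sharp p α) = α :=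
    LinearEquiv.apply_symm_apply (LinearEquiv.ofInjectiveOfFinrankEq (g.val p).toLinearMap _ _) α
  exact congrArg (fun f : TangentSpace I p →L[ℝ] ℝ ↦ f w) this

open VectorField in
/-- The right hand side of the Koszul formula, that is `g (∇_X Y) Z` at `p`. -/
def koszul (X Y Z : Π q : M, TangentSpace I q) (p : M) : ℝ :=
  (1 / 2 : ℝ) * (mvfderiv I (fun q ↦ g.val q (Y q) (Z q)) p (X p)
    + mvfderiv I (fun q ↦ g.val q (X q) (Z q)) p (Y p)
    - mvfderiv I (fun q ↦ g.val q (X q) (Y q)) p (Z p)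
    + g.val p (mlieBracket I X Y p) (Z p)
    - g.val p (mlieBracket I X Z p) (Y p)
    - g.val p (mlieBracket I Y Z p) (X p))

theorem koszul_tensorial_right {p : M} {X Y : Π q : M, TangentSpace I q}
    (hX : MDiffAt (T% X) p) (hY : MDiffAt (T% Y) p) :
    TensorialAt I E (fun Z ↦ g.koszul X Y Z p) p where
  smul {f Z} hf hZ := by
    have h1 := g.mdifferentiableAt_apply hY hZ
    have h2 := g.mdifferentiableAt_apply hX hZ
    simp [koszul, mvfderiv_fun_mul hf h1, mvfderiv_fun_mul hf h2,
      VectorField.mlieBracket_smul_right hf hZ, g.symm p (Z p)]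
    ring
  add {Z Z'} hZ hZ' := by
    simp [koszul, mvfderiv_fun_add (g.mdifferentiableAt_apply hY hZ) (g.mdifferentiableAt_apply hY hZ'),
      mvfderiv_fun_add (g.mdifferentiableAt_apply hX hZ) (g.mdifferentiableAt_apply hX hZ'),
      VectorField.mlieBracket_add_right hZ hZ']
    ring

theorem koszul_tensorial_left {p : M} {Y Z : Π q : M, TangentSpace I q}
    (hY : MDiffAt (T% Y) p) (hZ : MDiffAt (T% Z) p) :
    TensorialAt I E (fun X ↦ g.koszul X Y Z p) p where
  smul {f X} hf hX := by
    have h1 := g.mdifferentiableAt_apply hX hY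
    have h2 := g.mdifferentiableAt_apply hX hZ
    simp [koszul, mvfderiv_fun_mul hf h1, mvfderiv_fun_mul hf h2,
      VectorField.mlieBracket_smul_left hf hX]
    ring
  add {X X'} hX hX' := by
    simp [koszul, mvfderiv_fun_add (g.mdifferentiableAt_apply hX hY) (g.mdifferentiableAt_apply hX' hY),
      mvfderiv_fun_add (g.mdifferentiableAt_apply hX hZ) (g.mdifferentiableAt_apply hX' hZ),
      VectorField.mlieBracket_add_left hX hX']
    ring

open Classical in
/-- The vector `∇_x Y` at `p`, determined by the Koszul formula
(with value zero if `Y` is not differentiable at `p`). -/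
def koszulCov (Y : Π q : M, TangentSpace I q) (p : M) : TangentSpace I p →L[ℝ] TangentSpace I p :=
  haveI : FiniteDimensional ℝ (TangentSpace I p) := inferInstanceAs (FiniteDimensional ℝ E)
  haveI : T2Space (TangentSpace I p) := inferInstanceAs (T2Space E)
  if hY : MDiffAt (T% Y) p then
    LinearMap.toContinuousLinearMap (g.sharp p ∘ₗ
      (TensorialAt.mkHom₂ (I := I) (F := E) (F' := E) (fun X Z ↦ g.koszul X Y Z p) p
        (fun _ hZ ↦ g.koszul_tensorial_left hY hZ)
        (fun _ hX ↦ g.koszul_tensorial_right hX hY)).toLinearMap)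
  else 0

theorem val_koszulCov {p : M} {X Y Z : Π q : M, TangentSpace I q}
    (hX : MDiffAt (T% X) p) (hY : MDiffAt (T% Y) p) (hZ : MDiffAt (T% Z) p) :
    g.val p (g.koszulCov Y p (X p)) (Z p) = g.koszul X Y Z p := by
  simp only [koszulCov, hY, dif_pos]
  refine (g.val_sharp p _ _).trans ?_
  exact TensorialAt.mkHom₂_apply _ _ hX hZ

/-- The Levi-Civita connection. -/
def leviCivita : CovariantDerivative I E (TangentSpace I : M → Type _) where
  toFun := g.koszulCov
  isCovariantDerivativeOnUniv :=
    { add := by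
        intro Y Y' p hY hY' _
        apply VectorBundle.injective_eval_mdifferentiableAt_sec I E (TangentSpace I)
        ext X hX
        apply g.eq_of_val_eq
        intro w
        obtain ⟨Z, hZ, rfl⟩ : ∃ Z : Π q : M, TangentSpace I q, MDiffAt (T% Z) p ∧ Z p = w :=
          ⟨_, FiberBundle.mdifferentiableAt_extend I E w, by simp⟩
        have hYY' := mdifferentiableAt_add_section hY hY'
        simp only [add_apply, map_add]
        rw [g.val_koszulCov hX hYY' hZ, g.val_koszulCov hX hY hZ, g.val_koszulCov hX hY' hZ]
        simp [koszul, mvfderiv_fun_add (g.mdifferentiableAt_apply hY hZ) (g.mdifferentiableAt_apply hY' hZ),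
          mvfderiv_fun_add (g.mdifferentiableAt_apply hX hY) (g.mdifferentiableAt_apply hX hY'),
          VectorField.mlieBracket_add_right hY hY', VectorField.mlieBracket_add_left hY hY']
        ring
      leibniz := by
        intro Y f p hY hf _
        apply VectorBundle.injective_eval_mdifferentiableAt_sec I E (TangentSpace I)
        ext X hX
        apply g.eq_of_val_eq
        intro w
        obtain ⟨Z, hZ, rfl⟩ : ∃ Z : Π q : M, TangentSpace I q, MDiffAt (T% Z) p ∧ Z p = w :=
          ⟨_, FiberBundle.mdifferentiableAt_extend I E w, by simp⟩
        have hfY := hf.smul_section hY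
        simp only [add_apply, map_add]
        rw [g.val_koszulCov hX hfY hZ]
        simp only [smul_apply, map_smul]
        rw [g.val_koszulCov hX hY hZ]
        simp [koszul, mvfderiv_fun_mul hf (g.mdifferentiableAt_apply hY hZ),
          mvfderiv_fun_mul hf (g.mdifferentiableAt_apply hX hY), 
          VectorField.mlieBracket_smul_right hf hY, VectorField.mlieBracket_smul_left hf hY]
        rw [g.symm p (Y p) (X p)]
        ring }

/-- The Levi-Civita connection has no torsion. -/
theorem leviCivita_torsion {p : M} {X Y : Π q : M, TangentSpace I q}
    (hX : MDiffAt (T% X) p) (hY : MDiffAt (T% Y) p) :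
    g.leviCivita Y p (X p) - g.leviCivita X p (Y p) = VectorField.mlieBracket I X Y p := by
  apply g.eq_of_val_eq
  intro w
  obtain ⟨Z, hZ, rfl⟩ : ∃ Z : Π q : M, TangentSpace I q, MDiffAt (T% Z) p ∧ Z p = w :=
    ⟨_, FiberBundle.mdifferentiableAt_extend I E w, by simp⟩
  have h1 := g.val_koszulCov hX hY hZ
  have h2 := g.val_koszulCov hY hX hZ
  simp only [map_sub, sub_apply]
  change g.val p (g.koszulCov Y p (X p)) (Z p) - g.val p (g.koszulCov X p (Y p)) (Z p) = _
  have h3 : (fun q ↦ g.val q (Y q) (X q)) = (fun q ↦ g.val q (X q) (Y q)) :=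
    funext fun q ↦ g.symm q _ _
  rw [h1, h2, koszul, koszul, VectorField.mlieBracket_swap_apply (V := Y) (W := X), h3]
  simp
  ring

/-- The Levi-Civita connection is metric. -/
theorem leviCivita_metric {p : M} {X Y Z : Π q : M, TangentSpace I q}
    (hX : MDiffAt (T% X) p) (hY : MDiffAt (T% Y) p) (hZ : MDiffAt (T% Z) p) :
    mvfderiv I (fun q ↦ g.val q (Y q) (Z q)) p (X p) =
      g.val p (g.leviCivita Y p (X p)) (Z p) + g.val p (Y p) (g.leviCivita Z p (X p)) := by
  rw [g.symm p (Y p)]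
  have h3 : (fun q ↦ g.val q (Z q) (Y q)) = (fun q ↦ g.val q (Y q) (Z q)) :=
    funext fun q ↦ g.symm q _ _
  change _ = g.val p (g.koszulCov Y p (X p)) (Z p) + g.val p (g.koszulCov Z p (X p)) (Y p)
  rw [g.val_koszulCov hX hY hZ, g.val_koszulCov hX hZ hY, koszul, koszul, h3,
    VectorField.mlieBracket_swap_apply (V := Z) (W := Y)]
  simp
  ring

theorem nablaEnd_tensorial {φ : Π p : M, TangentSpace I p →L[ℝ] TangentSpace I p}
    (hφ : ContMDiff I (I.prod 𝓘(ℝ, E →L[ℝ] E)) ∞ (fun p ↦ TotalSpace.mk' (E →L[ℝ] E)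
      (E := fun p : M ↦ TangentSpace I p →L[ℝ] TangentSpace I p) p (φ p)))
    (p : M) : TensorialAt I E (fun Y : Π q : M, TangentSpace I q ↦
    g.leviCivita (fun q ↦ φ q (Y q)) p - φ p ∘L g.leviCivita Y p) p where
  smul {f Y} hf hY := by
    have h1 : (fun q ↦ φ q ((f • Y) q)) = f • (fun q ↦ φ q (Y q)) := by
      ext1 q
      simp
    have h2 := mdifferentiableAt_end_apply hφ hY
    rw [h1, g.leviCivita.isCovariantDerivativeOnUniv.leibniz hY hf,
      g.leviCivita.isCovariantDerivativeOnUniv.leibniz h2 hf]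
    ext x
    simp [smul_sub]
  add {Y Y'} hY hY' := by
    have h1 : (fun q ↦ φ q ((Y + Y') q)) = (fun q ↦ φ q (Y q)) + (fun q ↦ φ q (Y' q)) := by
      ext1 q
      simp
    rw [h1, g.leviCivita.isCovariantDerivativeOnUniv.add hY hY',
      g.leviCivita.isCovariantDerivativeOnUniv.add (mdifferentiableAt_end_apply hφ hY)
        (mdifferentiableAt_end_apply hφ hY')]
    ext x
    simp
    abel

/-- The covariant derivative of a smooth field `φ` of endomorphisms for the Levi-Civita connection:
`g.nablaEnd φ hφ p y x` is `(∇_x φ) y`. -/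
def nablaEnd (φ : Π p : M, TangentSpace I p →L[ℝ] TangentSpace I p)
    (hφ : ContMDiff I (I.prod 𝓘(ℝ, E →L[ℝ] E)) ∞ (fun p ↦ TotalSpace.mk' (E →L[ℝ] E)
      (E := fun p : M ↦ TangentSpace I p →L[ℝ] TangentSpace I p) p (φ p)))
    (p : M) : TangentSpace I p →L[ℝ] TangentSpace I p →L[ℝ] TangentSpace I p :=
  TensorialAt.mkHom (I := I) (F := E) (fun Y : Π q : M, TangentSpace I q ↦
    g.leviCivita (fun q ↦ φ q (Y q)) p - φ p ∘L g.leviCivita Y p) p (g.nablaEnd_tensorial hφ p)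

/-- `(∇_x φ) Y = ∇_x (φ Y) - φ (∇_x Y)`. -/
theorem nablaEnd_apply {φ : Π p : M, TangentSpace I p →L[ℝ] TangentSpace I p}
    (hφ : ContMDiff I (I.prod 𝓘(ℝ, E →L[ℝ] E)) ∞ (fun p ↦ TotalSpace.mk' (E →L[ℝ] E)
      (E := fun p : M ↦ TangentSpace I p →L[ℝ] TangentSpace I p) p (φ p)))
    {p : M} {Y : Π q : M, TangentSpace I q}
    (hY : MDiffAt (T% Y) p) (x : TangentSpace I p) :
    g.nablaEnd φ hφ p (Y p) x =
      g.leviCivita (fun q ↦ φ q (Y q)) p x - φ p (g.leviCivita Y p x) := by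
  rw [nablaEnd, TensorialAt.mkHom_apply _ hY]
  rfl

end PseudoRiemannianMetric
end PseudoRiemannian

/-! ### Linear algebra in one tangent space -/

/-- A `(2n+1)`-dimensional real vector space with an almost paracontact structure `(φ, ξ, η)`
and a compatible metric `g`. -/
structure AlmostParacontactMetricSpace (n : ℕ) (V : Type*) [AddCommGroup V] [Module ℝ V] where
  φ : V →ₗ[ℝ] V
  ξ : V
  η : V →ₗ[ℝ] ℝ
  g : V →ₗ[ℝ] V →ₗ[ℝ] ℝ
  finrank_eq : Module.finrank ℝ V = 2 * n + 1
  phi_phi (x : V) : φ (φ x) = x - η x • ξ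
  eta_xi : η ξ = 1
  phi_xi : φ ξ = 0
  g_symm (x y : V) : g x y = g y x
  g_nondegenerate (x : V) (h : ∀ y, g x y = 0) : x = 0
  g_phi_phi (x y : V) : g (φ x) (φ y) = -g x y + η x * η y

namespace AlmostParacontactMetricSpace

variable {n : ℕ} {V : Type*} [AddCommGroup V] [Module ℝ V]
  (P : AlmostParacontactMetricSpace n V)

/-- The paracontact hyperplane `𝔻 = ker η`. -/
abbrev D : Submodule ℝ V := LinearMap.ker P.η

/-- The horizontal part `h x = φ² x`. -/
def h (x : V) : V := P.φ (P.φ x)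

/-- `g^{ij} B(e_i, e_j)` for a basis `e` of `𝔻`, where `(g^{ij})` is inverse to `(g(e_i, e_j))`. -/
def traceWith {ι : Type*} [Fintype ι] [DecidableEq ι] (e : Module.Basis ι ℝ P.D)
    (B : V → V → ℝ) : ℝ :=
  ∑ i, ∑ j, (Matrix.of fun k l ↦ P.g (e k) (e l))⁻¹ i j * B (e i) (e j)

/-- The metric trace over `𝔻` (computed in some basis; see `trace_eq_traceWith`). -/
def trace (B : V → V → ℝ) : ℝ :=
  haveI : FiniteDimensional ℝ V := Module.finite_of_finrank_pos (by rw [P.finrank_eq]; omega)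
  P.traceWith (Module.finBasis ℝ P.D) B

theorem traceWith_eq_traceWith_aux {ι : Type*} [Fintype ι] [DecidableEq ι]
    (e f : Module.Basis ι ℝ P.D) (B : V →ₗ[ℝ] V →ₗ[ℝ] ℝ) :
    P.traceWith e (fun x y ↦ B x y) = P.traceWith f (fun x y ↦ B x y) := by
  have key : ∀ C : V →ₗ[ℝ] V →ₗ[ℝ] ℝ, (Matrix.of fun k l ↦ C (e k) (e l)) =
      (f.toMatrix e).transpose * (Matrix.of fun k l ↦ C (f k) (f l)) * f.toMatrix e := by
    intro C
    ext k l
    have hk : ∀ k, ((e k : P.D) : V) = ∑ i, f.toMatrix e i k • ((f i : P.D) : V) := fun k ↦ by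
      have := congrArg (Submodule.subtype P.D) (f.sum_toMatrix_smul_self e k)
      rw [map_sum] at this
      simpa using this.symm
    simp only [Matrix.of_apply, Matrix.mul_apply, Matrix.transpose_apply]
    rw [hk k, hk l]
    simp only [map_sum, map_smul, LinearMap.sum_apply, LinearMap.smul_apply, smul_eq_mul,
      Finset.sum_mul, Finset.mul_sum]
    exact Finset.sum_congr rfl fun i _ ↦ Finset.sum_congr rfl fun j _ ↦ by ring
  have tr : ∀ e : Module.Basis ι ℝ P.D, P.traceWith e (fun x y ↦ B x y) = Matrix.trace
      ((Matrix.of fun k l ↦ P.g (e k) (e l))⁻¹ *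
        (Matrix.of fun k l ↦ B (e k) (e l)).transpose) := by
    intro e
    simp [traceWith, Matrix.trace, Matrix.mul_apply]
  have hP : IsUnit (f.toMatrix e).det := by
    have := f.invertibleToMatrix e
    exact Matrix.isUnit_det_of_invertible _
  have hP' : IsUnit (f.toMatrix e).transpose.det := by rwa [Matrix.det_transpose]
  rw [tr e, tr f, key P.g, key B, Matrix.mul_inv_rev, Matrix.mul_inv_rev, Matrix.transpose_mul,
    Matrix.transpose_mul, Matrix.transpose_transpose, Matrix.mul_assoc, Matrix.mul_assoc,
    Matrix.nonsing_inv_mul_cancel_left _ _ hP', Matrix.trace_mul_comm, Matrix.mul_assoc,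
    Matrix.mul_assoc, Matrix.mul_nonsing_inv _ hP, Matrix.mul_one]

/-- The metric trace does not depend on the basis. -/
theorem traceWith_eq_traceWith {ι κ : Type*} [Fintype ι] [DecidableEq ι] [Fintype κ]
    [DecidableEq κ] (e : Module.Basis ι ℝ P.D) (f : Module.Basis κ ℝ P.D)
    (B : V →ₗ[ℝ] V →ₗ[ℝ] ℝ) :
    P.traceWith e (fun x y ↦ B x y) = P.traceWith f (fun x y ↦ B x y) := by
  rw [P.traceWith_eq_traceWith_aux e (f.reindex (e.indexEquiv f).symm) B]
  have hG : (Matrix.of fun k l ↦ P.g (f.reindex (e.indexEquiv f).symm k)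
      (f.reindex (e.indexEquiv f).symm l)) =
      (Matrix.of fun k l ↦ P.g (f k) (f l)).submatrix (e.indexEquiv f) (e.indexEquiv f) := by
    ext k l
    simp
  simp only [traceWith, hG, Matrix.inv_submatrix_equiv, Matrix.submatrix_apply]
  refine Fintype.sum_equiv (e.indexEquiv f) _ _ fun i ↦
    Fintype.sum_equiv (e.indexEquiv f) _ _ fun j ↦ by simp

theorem trace_eq_traceWith {ι : Type*} [Fintype ι] [DecidableEq ι] (e : Module.Basis ι ℝ P.D)
    (B : V →ₗ[ℝ] V →ₗ[ℝ] ℝ) :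
    P.trace (fun x y ↦ B x y) = P.traceWith e (fun x y ↦ B x y) :=
  P.traceWith_eq_traceWith _ e B

/-- The space `𝓕` of the structure tensors. -/
def structureTensors : Submodule ℝ (V →ₗ[ℝ] V →ₗ[ℝ] V →ₗ[ℝ] ℝ) where
  carrier := {F | (∀ x y z, F x y z = -F x z y) ∧
    ∀ x y z, F x y z = F x (P.φ y) (P.φ z) - P.η y * F x z P.ξ + P.η z * F x y P.ξ}
  zero_mem' := by simp
  add_mem' := by
    rintro F F' ⟨h1, h2⟩ ⟨h1', h2'⟩
    refine ⟨fun x y z ↦ ?_, fun x y z ↦ ?_⟩ <;> simp only [LinearMap.add_apply]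
    · linear_combination h1 x y z + h1' x y z
    · linear_combination h2 x y z + h2' x y z
  smul_mem' := by
    rintro c F ⟨h1, h2⟩
    refine ⟨fun x y z ↦ ?_, fun x y z ↦ ?_⟩ <;> simp only [LinearMap.smul_apply, smul_eq_mul]
    · linear_combination c * h1 x y z
    · linear_combination c * h2 x y z

/-- `θ_F(z) = g^{ij} F(e_i, e_j, z)`. -/
def theta (F : V →ₗ[ℝ] V →ₗ[ℝ] V →ₗ[ℝ] ℝ) (z : V) : ℝ := P.trace fun x y ↦ F x y z

/-- `θ*_F(z) = g^{ij} F(e_i, φ e_j, z)`. -/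
def thetaStar (F : V →ₗ[ℝ] V →ₗ[ℝ] V →ₗ[ℝ] ℝ) (z : V) : ℝ := P.trace fun x y ↦ F x (P.φ y) z

@[simp] theorem theta_zero (z : V) : P.theta 0 z = 0 := by simp [theta, trace, traceWith]

@[simp] theorem theta_add (F F' : V →ₗ[ℝ] V →ₗ[ℝ] V →ₗ[ℝ] ℝ) (z : V) :
    P.theta (F + F') z = P.theta F z + P.theta F' z := by
  simp [theta, trace, traceWith, mul_add, Finset.sum_add_distrib]

@[simp] theorem theta_smul (c : ℝ) (F : V →ₗ[ℝ] V →ₗ[ℝ] V →ₗ[ℝ] ℝ) (z : V) :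
    P.theta (c • F) z = c * P.theta F z := by
  simp [theta, trace, traceWith, Finset.mul_sum, mul_left_comm]

@[simp] theorem thetaStar_zero (z : V) : P.thetaStar 0 z = 0 := by
  simp [thetaStar, trace, traceWith]

@[simp] theorem thetaStar_add (F F' : V →ₗ[ℝ] V →ₗ[ℝ] V →ₗ[ℝ] ℝ) (z : V) :
    P.thetaStar (F + F') z = P.thetaStar F z + P.thetaStar F' z := by
  simp [thetaStar, trace, traceWith, mul_add, Finset.sum_add_distrib]

@[simp] theorem thetaStar_smul (c : ℝ) (F : V →ₗ[ℝ] V →ₗ[ℝ] V →ₗ[ℝ] ℝ) (z : V) :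
    P.thetaStar (c • F) z = c * P.thetaStar F z := by
  simp [thetaStar, trace, traceWith, Finset.mul_sum, mul_left_comm]

/-- The space `𝔾₁` (it is zero for `n = 1`). -/
def G₁ : Submodule ℝ (V →ₗ[ℝ] V →ₗ[ℝ] V →ₗ[ℝ] ℝ) where
  carrier := {F | F ∈ P.structureTensors ∧ ∀ x y z, F x y z = 1 / (2 * ((n : ℝ) - 1)) *
    (P.g x (P.φ y) * P.theta F (P.φ z) - P.g x (P.φ z) * P.theta F (P.φ y)
      - P.g (P.φ x) (P.φ y) * P.theta F (P.h z) + P.g (P.φ x) (P.φ z) * P.theta F (P.h y))}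
  zero_mem' := ⟨zero_mem _, by simp⟩
  add_mem' := by
    rintro F F' ⟨h0, h1⟩ ⟨h0', h1'⟩
    refine ⟨add_mem h0 h0', fun x y z ↦ ?_⟩
    simp only [LinearMap.add_apply, theta_add]
    linear_combination h1 x y z + h1' x y z
  smul_mem' := by
    rintro c F ⟨h0, h1⟩
    refine ⟨Submodule.smul_mem _ c h0, fun x y z ↦ ?_⟩
    simp only [LinearMap.smul_apply, smul_eq_mul, theta_smul]
    linear_combination c * h1 x y z

/-- The space `𝔾₂`. -/
def G₂ : Submodule ℝ (V →ₗ[ℝ] V →ₗ[ℝ] V →ₗ[ℝ] ℝ) where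
  carrier := {F | F ∈ P.structureTensors ∧ (∀ x y z, F (P.φ x) (P.φ y) z = -F x y z) ∧
    ∀ z, P.theta F z = 0}
  zero_mem' := ⟨zero_mem _, by simp, by simp⟩
  add_mem' := by
    rintro F F' ⟨h0, h1, h2⟩ ⟨h0', h1', h2'⟩
    refine ⟨add_mem h0 h0', fun x y z ↦ ?_, fun z ↦ by simp [h2, h2']⟩
    simp only [LinearMap.add_apply]
    linear_combination h1 x y z + h1' x y z
  smul_mem' := by
    rintro c F ⟨h0, h1, h2⟩
    refine ⟨Submodule.smul_mem _ c h0, fun x y z ↦ ?_, fun z ↦ by simp [h2]⟩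
    simp only [LinearMap.smul_apply, smul_eq_mul]
    linear_combination c * h1 x y z

/-- The space `𝔾₅`. -/
def G₅ : Submodule ℝ (V →ₗ[ℝ] V →ₗ[ℝ] V →ₗ[ℝ] ℝ) where
  carrier := {F | F ∈ P.structureTensors ∧ ∀ x y z, F x y z = P.theta F P.ξ / (2 * n) *
    (P.η y * P.g (P.φ x) (P.φ z) - P.η z * P.g (P.φ x) (P.φ y))}
  zero_mem' := ⟨zero_mem _, by simp⟩
  add_mem' := by
    rintro F F' ⟨h0, h1⟩ ⟨h0', h1'⟩
    refine ⟨add_mem h0 h0', fun x y z ↦ ?_⟩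
    simp only [LinearMap.add_apply, theta_add]
    linear_combination h1 x y z + h1' x y z
  smul_mem' := by
    rintro c F ⟨h0, h1⟩
    refine ⟨Submodule.smul_mem _ c h0, fun x y z ↦ ?_⟩
    simp only [LinearMap.smul_apply, smul_eq_mul, theta_smul]
    linear_combination c * h1 x y z

/-- The space `𝔾₆`. -/
def G₆ : Submodule ℝ (V →ₗ[ℝ] V →ₗ[ℝ] V →ₗ[ℝ] ℝ) where
  carrier := {F | F ∈ P.structureTensors ∧ ∀ x y z, F x y z = -(P.thetaStar F P.ξ / (2 * n)) *
    (P.η y * P.g x (P.φ z) - P.η z * P.g x (P.φ y))}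
  zero_mem' := ⟨zero_mem _, by simp⟩
  add_mem' := by
    rintro F F' ⟨h0, h1⟩ ⟨h0', h1'⟩
    refine ⟨add_mem h0 h0', fun x y z ↦ ?_⟩
    simp only [LinearMap.add_apply, thetaStar_add]
    linear_combination h1 x y z + h1' x y z
  smul_mem' := by
    rintro c F ⟨h0, h1⟩
    refine ⟨Submodule.smul_mem _ c h0, fun x y z ↦ ?_⟩
    simp only [LinearMap.smul_apply, smul_eq_mul, thetaStar_smul]
    linear_combination c * h1 x y z

/-- The space `𝔾₇`. -/
def G₇ : Submodule ℝ (V →ₗ[ℝ] V →ₗ[ℝ] V →ₗ[ℝ] ℝ) where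
  carrier := {F | F ∈ P.structureTensors ∧
    (∀ x y z, F x y z = -(P.η y * F x z P.ξ) + P.η z * F x y P.ξ) ∧
    (∀ x y, F x y P.ξ = -F y x P.ξ) ∧ (∀ x y, F x y P.ξ = -F (P.φ x) (P.φ y) P.ξ) ∧
    P.thetaStar F P.ξ = 0}
  zero_mem' := ⟨zero_mem _, by simp, by simp, by simp, by simp⟩
  add_mem' := by
    rintro F F' ⟨h0, h1, h2, h3, h4⟩ ⟨h0', h1', h2', h3', h4'⟩
    refine ⟨add_mem h0 h0', fun x y z ↦ ?_, fun x y ↦ ?_, fun x y ↦ ?_, by simp [h4, h4']⟩ <;>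
      simp only [LinearMap.add_apply]
    · linear_combination h1 x y z + h1' x y z
    · linear_combination h2 x y + h2' x y
    · linear_combination h3 x y + h3' x y
  smul_mem' := by
    rintro c F ⟨h0, h1, h2, h3, h4⟩
    refine ⟨Submodule.smul_mem _ c h0, fun x y z ↦ ?_, fun x y ↦ ?_, fun x y ↦ ?_, by simp [h4]⟩ <;>
      simp only [LinearMap.smul_apply, smul_eq_mul]
    · linear_combination c * h1 x y z
    · linear_combination c * h2 x y
    · linear_combination c * h3 x y

/-- The space `𝔾₈`. -/
def G₈ : Submodule ℝ (V →ₗ[ℝ] V →ₗ[ℝ] V →ₗ[ℝ] ℝ) where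
  carrier := {F | F ∈ P.structureTensors ∧
    (∀ x y z, F x y z = -(P.η y * F x z P.ξ) + P.η z * F x y P.ξ) ∧
    (∀ x y, F x y P.ξ = F y x P.ξ) ∧ (∀ x y, F x y P.ξ = -F (P.φ x) (P.φ y) P.ξ) ∧
    P.theta F P.ξ = 0}
  zero_mem' := ⟨zero_mem _, by simp, by simp, by simp, by simp⟩
  add_mem' := by
    rintro F F' ⟨h0, h1, h2, h3, h4⟩ ⟨h0', h1', h2', h3', h4'⟩
    refine ⟨add_mem h0 h0', fun x y z ↦ ?_, fun x y ↦ ?_, fun x y ↦ ?_, by simp [h4, h4']⟩ <;>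
      simp only [LinearMap.add_apply]
    · linear_combination h1 x y z + h1' x y z
    · linear_combination h2 x y + h2' x y
    · linear_combination h3 x y + h3' x y
  smul_mem' := by
    rintro c F ⟨h0, h1, h2, h3, h4⟩
    refine ⟨Submodule.smul_mem _ c h0, fun x y z ↦ ?_, fun x y ↦ ?_, fun x y ↦ ?_, by simp [h4]⟩ <;>
      simp only [LinearMap.smul_apply, smul_eq_mul]
    · linear_combination c * h1 x y z
    · linear_combination c * h2 x y
    · linear_combination c * h3 x y

end AlmostParacontactMetricSpace

/-- The labels of the basic classes `𝔾₁`, `𝔾₂`, `𝔾₅`, `𝔾₆`, `𝔾₇`, `𝔾₈`. -/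
inductive BasicClass
  | G₁ | G₂ | G₅ | G₆ | G₇ | G₈

/-- The subspace of `𝓕` that belongs to a label. -/
def BasicClass.subspace {n : ℕ} {V : Type*} [AddCommGroup V] [Module ℝ V]
    (P : AlmostParacontactMetricSpace n V) :
    BasicClass → Submodule ℝ (V →ₗ[ℝ] V →ₗ[ℝ] V →ₗ[ℝ] ℝ)
  | .G₁ => P.G₁
  | .G₂ => P.G₂
  | .G₅ => P.G₅
  | .G₆ => P.G₆
  | .G₇ => P.G₇
  | .G₈ => P.G₈

/-! ### Almost paracontact metric manifolds -/

/-- An almost paracontact metric structure `(φ, ξ, η, g)` on the `(2n+1)`-dimensional manifold `M`;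
all tensor fields are smooth. -/
structure AlmostParacontactMetricStructure (n : ℕ) (M : Type*) [TopologicalSpace M]
    [ChartedSpace (EuclideanSpace ℝ (Fin (2 * n + 1))) M] [IsManifold (𝓡 (2 * n + 1)) ∞ M] where
  φ (p : M) : TangentSpace (𝓡 (2 * n + 1)) p →L[ℝ] TangentSpace (𝓡 (2 * n + 1)) p
  ξ (p : M) : TangentSpace (𝓡 (2 * n + 1)) p
  η (p : M) : TangentSpace (𝓡 (2 * n + 1)) p →L[ℝ] ℝ
  g : PseudoRiemannianMetric (𝓡 (2 * n + 1)) M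
  contMDiff_phi : ContMDiff (𝓡 (2 * n + 1)) ((𝓡 (2 * n + 1)).prod
      𝓘(ℝ, EuclideanSpace ℝ (Fin (2 * n + 1)) →L[ℝ] EuclideanSpace ℝ (Fin (2 * n + 1)))) ∞
    (fun p ↦ TotalSpace.mk'
      (EuclideanSpace ℝ (Fin (2 * n + 1)) →L[ℝ] EuclideanSpace ℝ (Fin (2 * n + 1)))
      (E := fun p : M ↦ TangentSpace (𝓡 (2 * n + 1)) p →L[ℝ] TangentSpace (𝓡 (2 * n + 1)) p)
      p (φ p))
  contMDiff_xi : ContMDiff (𝓡 (2 * n + 1)) (𝓡 (2 * n + 1)).tangent ∞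
    (fun p ↦ (⟨p, ξ p⟩ : TangentBundle (𝓡 (2 * n + 1)) M))
  contMDiff_eta : ContMDiff (𝓡 (2 * n + 1)) ((𝓡 (2 * n + 1)).prod
      𝓘(ℝ, EuclideanSpace ℝ (Fin (2 * n + 1)) →L[ℝ] ℝ)) ∞
    (fun p ↦ TotalSpace.mk' (EuclideanSpace ℝ (Fin (2 * n + 1)) →L[ℝ] ℝ)
      (E := fun p : M ↦ TangentSpace (𝓡 (2 * n + 1)) p →L[ℝ] ℝ) p (η p))
  phi_phi (p : M) (x : TangentSpace (𝓡 (2 * n + 1)) p) : φ p (φ p x) = x - η p x • ξ p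
  eta_xi (p : M) : η p (ξ p) = 1
  phi_xi (p : M) : φ p (ξ p) = 0
  g_phi_phi (p : M) (x y : TangentSpace (𝓡 (2 * n + 1)) p) :
    g.val p (φ p x) (φ p y) = -g.val p x y + η p x * η p y

namespace AlmostParacontactMetricStructure

variable {n : ℕ} {M : Type*} [TopologicalSpace M]
  [ChartedSpace (EuclideanSpace ℝ (Fin (2 * n + 1))) M] [IsManifold (𝓡 (2 * n + 1)) ∞ M]
  (S : AlmostParacontactMetricStructure n M)

/-- The structure induced on the tangent space at `p`. -/
def atPoint (p : M) : AlmostParacontactMetricSpace n (TangentSpace (𝓡 (2 * n + 1)) p) where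
  φ := (S.φ p).toLinearMap
  ξ := S.ξ p
  η := (S.η p).toLinearMap
  g := LinearMap.mk₂ ℝ (fun x y ↦ S.g.val p x y) (by simp) (by simp) (by simp) (by simp)
  finrank_eq := finrank_euclideanSpace_fin (𝕜 := ℝ) (n := 2 * n + 1)
  phi_phi := S.phi_phi p
  eta_xi := S.eta_xi p
  phi_xi := S.phi_xi p
  g_symm := S.g.symm p
  g_nondegenerate := S.g.nondegenerate p
  g_phi_phi := S.g_phi_phi p

/-- `dη(X, Y) = ½ (X η(Y) - Y η(X) - η([X, Y]))`. -/
def dEta (X Y : Π p : M, TangentSpace (𝓡 (2 * n + 1)) p) (p : M) : ℝ :=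
  (1 / 2 : ℝ) * (mvfderiv (𝓡 (2 * n + 1)) (fun q ↦ S.η q (Y q)) p (X p)
    - mvfderiv (𝓡 (2 * n + 1)) (fun q ↦ S.η q (X q)) p (Y p)
    - S.η p (VectorField.mlieBracket (𝓡 (2 * n + 1)) X Y p))

/-- `N(X, Y) = φ²[X, Y] + [φX, φY] - φ[φX, Y] - φ[X, φY]`. -/
def nijenhuis (X Y : Π p : M, TangentSpace (𝓡 (2 * n + 1)) p) (p : M) :
    TangentSpace (𝓡 (2 * n + 1)) p :=
  S.φ p (S.φ p (VectorField.mlieBracket (𝓡 (2 * n + 1)) X Y p))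
    + VectorField.mlieBracket (𝓡 (2 * n + 1)) (fun q ↦ S.φ q (X q)) (fun q ↦ S.φ q (Y q)) p
    - S.φ p (VectorField.mlieBracket (𝓡 (2 * n + 1)) (fun q ↦ S.φ q (X q)) Y p)
    - S.φ p (VectorField.mlieBracket (𝓡 (2 * n + 1)) X (fun q ↦ S.φ q (Y q)) p)

/-- Normality: `N(X, Y) - 2 dη(X, Y) ξ = 0` for all smooth vector fields `X`, `Y`. -/
def IsNormal : Prop :=
  ∀ X Y : Cₛ^∞⟮𝓡 (2 * n + 1); EuclideanSpace ℝ (Fin (2 * n + 1)),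
      (TangentSpace (𝓡 (2 * n + 1)) : M → Type _)⟯, ∀ p : M,
    S.nijenhuis (fun q ↦ X q) (fun q ↦ Y q) p
      - (2 * S.dEta (fun q ↦ X q) (fun q ↦ Y q) p) • S.ξ p = 0

/-- The tensor `∇φ` for the Levi-Civita connection: `S.nablaPhi p y x` is `(∇_x φ) y`. -/
def nablaPhi (p : M) : TangentSpace (𝓡 (2 * n + 1)) p →L[ℝ]
    TangentSpace (𝓡 (2 * n + 1)) p →L[ℝ] TangentSpace (𝓡 (2 * n + 1)) p :=
  S.g.nablaEnd S.φ S.contMDiff_phi p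

/-- The structure tensor `F(x, y, z) = g((∇_x φ) y, z)`. -/
def F (p : M) : TangentSpace (𝓡 (2 * n + 1)) p →ₗ[ℝ] TangentSpace (𝓡 (2 * n + 1)) p →ₗ[ℝ]
    TangentSpace (𝓡 (2 * n + 1)) p →ₗ[ℝ] ℝ :=
  LinearMap.mk₂ ℝ (fun x y ↦ (S.g.val p (S.nablaPhi p y x)).toLinearMap)
    (by intros; ext; simp) (by intros; ext; simp) (by intros; ext; simp) (by intros; ext; simp)

/-- The manifold belongs to the class `⨁ i ∈ s, 𝔾ᵢ`: at each point the sum of the subspaces is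
direct and contains the structure tensor. For `s = {i}` this is the class `𝔾ᵢ` itself. -/
def InDirectSum (s : Set BasicClass) : Prop :=
  ∀ p : M, iSupIndep (fun i : s ↦ i.1.subspace (S.atPoint p)) ∧
    S.F p ∈ ⨆ i : s, i.1.subspace (S.atPoint p)

end AlmostParacontactMetricStructure
end

namespace AlmostParacontactMetricSpace

variable {n : ℕ} {V : Type*} [AddCommGroup V] [Module ℝ V]
  (P : AlmostParacontactMetricSpace n V)

/-! ### Elementary identities -/

theorem phi_phi_phi (x : V) : P.φ (P.φ (P.φ x)) = P.φ x := by
  rw [P.phi_phi x, map_sub, map_smul, P.phi_xi, smul_zero, sub_zero]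

theorem eta_phi (x : V) : P.η (P.φ x) = 0 := by
  have h := P.phi_phi (P.φ x)
  rw [P.phi_phi_phi x] at h
  have h2 := congrArg P.η h
  simpa [P.eta_xi] using h2

theorem phi_phi_of_eta_eq_zero {x : V} (hx : P.η x = 0) : P.φ (P.φ x) = x := by
  simp [P.phi_phi, hx]

theorem g_xi (x : V) : P.g x P.ξ = P.η x := by
  have h := P.g_phi_phi x P.ξ
  rw [P.phi_xi, P.eta_xi, map_zero] at h
  linarith

theorem g_phi_left (x y : V) : P.g (P.φ x) y = -P.g x (P.φ y) := by
  have h := P.g_phi_phi x (P.φ y)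
  rw [P.phi_phi y, map_sub, map_smul, P.g_xi, P.eta_phi, P.eta_phi] at h
  simpa using h

theorem g_phi_self (x : V) : P.g x (P.φ x) = 0 := by
  have h := P.g_phi_left x x
  rw [P.g_symm] at h
  linarith

/-! ### The metric trace over `𝔻` -/

theorem finiteDimensional {n : ℕ} {V : Type*} [AddCommGroup V] [Module ℝ V]
    (P : AlmostParacontactMetricSpace n V) : FiniteDimensional ℝ V :=
  Module.finite_of_finrank_pos (by rw [P.finrank_eq]; omega)

theorem finrank_D : Module.finrank ℝ P.D = 2 * n := by
  have := P.finiteDimensional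
  have h := Module.Dual.finrank_ker_add_one_of_ne_zero (f := P.η)
    (fun h ↦ by simpa [h] using P.eta_xi)
  rw [P.finrank_eq] at h
  simpa using h

theorem eta_coe (x : P.D) : P.η x = 0 := LinearMap.mem_ker.1 x.2

section gram

/-- The Gram matrix of a basis of `𝔻`. -/
noncomputable def gram {ι : Type*} (e : Module.Basis ι ℝ P.D) : Matrix ι ι ℝ := Matrix.of fun k l ↦ P.g (e k) (e l)

theorem gram_apply {ι : Type*} (e : Module.Basis ι ℝ P.D) (k l : ι) : P.gram e k l = P.g (e k) (e l) := rfl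

theorem transpose_gram {ι : Type*} (e : Module.Basis ι ℝ P.D) : (P.gram e).transpose = P.gram e := by
  ext k l
  exact P.g_symm _ _

variable {ι : Type*} [Fintype ι] [DecidableEq ι] (e : Module.Basis ι ℝ P.D)

theorem isUnit_det_gram : IsUnit (P.gram e).det := by
  rw [isUnit_iff_ne_zero]
  intro h
  obtain ⟨v, hv, hM⟩ := Matrix.exists_mulVec_eq_zero_iff.2 h
  apply hv
  have hu : ∑ i, v i • e i = 0 := by
    have h1 : ∀ x : P.D, P.g x (∑ i, v i • e i : P.D) = 0 := by
      intro x
      have h2 : ((P.g.flip (∑ i, v i • e i : P.D)) ∘ₗ P.D.subtype) = 0 := by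
        refine e.ext fun k ↦ ?_
        have h3 := congrFun hM k
        simp only [Matrix.mulVec, dotProduct, gram_apply, Pi.zero_apply] at h3
        change P.g (e k) ((∑ i, v i • e i : P.D) : V) = 0
        rw [← h3]
        simp [mul_comm]
      exact congrArg (fun f : P.D →ₗ[ℝ] ℝ ↦ f x) h2
    apply Subtype.ext
    refine P.g_nondegenerate _ fun y ↦ ?_
    have hy : y = P.φ (P.φ y) + P.η y • P.ξ := by simp [P.phi_phi]
    rw [hy, map_add, map_smul, P.g_xi, P.eta_coe, smul_zero, add_zero, P.g_symm]
    exact h1 ⟨P.φ (P.φ y), P.eta_phi _⟩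
  funext i
  exact (Fintype.linearIndependent_iff.1 e.linearIndependent) v hu i

theorem transpose_inv_gram : ((P.gram e)⁻¹).transpose = (P.gram e)⁻¹ := by
  rw [Matrix.transpose_nonsing_inv, P.transpose_gram]

theorem traceWith_flip (B : V → V → ℝ) :
    P.traceWith e (fun x y ↦ B y x) = P.traceWith e B := by
  unfold traceWith
  rw [Finset.sum_comm]
  refine Finset.sum_congr rfl fun i _ ↦ Finset.sum_congr rfl fun j _ ↦ ?_
  change (P.gram e)⁻¹ j i * _ = (P.gram e)⁻¹ i j * _
  rw [show (P.gram e)⁻¹ j i = (P.gram e)⁻¹ i j from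
    congrFun (congrFun (P.transpose_inv_gram e) i) j]

theorem traceWith_g : P.traceWith e (fun x y ↦ P.g x y) = Fintype.card ι := by
  have h := congrArg Matrix.trace (Matrix.nonsing_inv_mul _ (P.isUnit_det_gram e))
  rw [Matrix.trace_one] at h
  rw [← h]
  simp only [Matrix.trace, Matrix.diag, Matrix.mul_apply]
  refine Finset.sum_congr rfl fun i _ ↦ Finset.sum_congr rfl fun j _ ↦ ?_
  change (P.gram e)⁻¹ i j * _ = _
  rw [P.gram_apply, P.g_symm]

theorem traceWith_g_mul (α : V →ₗ[ℝ] ℝ) (z : P.D) :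
    P.traceWith e (fun x y ↦ P.g x z * α y) = α z := by
  have hz : (z : V) = ∑ k, e.repr z k • (e k : V) := by
    have := congrArg (Submodule.subtype P.D) (e.sum_repr z)
    rw [map_sum] at this
    simpa using this.symm
  have h1 : ∀ i, P.g (e i) z = ∑ k, P.gram e i k * e.repr z k := fun i ↦ by
    conv_lhs => rw [hz]
    simp [gram_apply, mul_comm]
  have h2 : ∀ j k, ∑ i, (P.gram e)⁻¹ i j * P.gram e i k = if j = k then 1 else 0 := fun j k ↦ by
    have := congrFun (congrFun (Matrix.nonsing_inv_mul _ (P.isUnit_det_gram e)) j) k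
    rw [Matrix.mul_apply, Matrix.one_apply] at this
    rw [← this]
    refine Finset.sum_congr rfl fun i _ ↦ ?_
    rw [← P.transpose_inv_gram e, Matrix.transpose_apply, P.transpose_inv_gram e]
  calc P.traceWith e (fun x y ↦ P.g x z * α y)
      = ∑ i, ∑ j, ∑ k, (P.gram e)⁻¹ i j * P.gram e i k * (e.repr z k * α (e j)) := by
        unfold traceWith
        refine Finset.sum_congr rfl fun i _ ↦ Finset.sum_congr rfl fun j _ ↦ ?_
        change (P.gram e)⁻¹ i j * (P.g (e i) z * α (e j)) = _
        rw [h1, Finset.sum_mul, Finset.mul_sum]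
        exact Finset.sum_congr rfl fun k _ ↦ by ring
    _ = ∑ j, ∑ k, (∑ i, (P.gram e)⁻¹ i j * P.gram e i k) * (e.repr z k * α (e j)) := by
        rw [Finset.sum_comm]
        refine Finset.sum_congr rfl fun j _ ↦ ?_
        rw [Finset.sum_comm]
        exact Finset.sum_congr rfl fun k _ ↦ by rw [Finset.sum_mul]
    _ = α z := by
        conv_rhs => rw [hz]
        simp [h2]

end gram

/-- The restriction of `φ` to `𝔻`, which is an involution. -/
noncomputable def phiD : P.D ≃ₗ[ℝ] P.D :=
  LinearEquiv.ofInvolutive (P.φ.restrict fun x _ ↦ P.eta_phi x) fun x ↦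
    Subtype.ext (P.phi_phi_of_eta_eq_zero (P.eta_coe x))

theorem coe_phiD (x : P.D) : (P.phiD x : V) = P.φ x := rfl

theorem trace_congr {B B' : V → V → ℝ}
    (h : ∀ x y, P.η x = 0 → P.η y = 0 → B x y = B' x y) : P.trace B = P.trace B' := by
  unfold trace traceWith
  exact Finset.sum_congr rfl fun i _ ↦ Finset.sum_congr rfl fun j _ ↦ by
    rw [h _ _ (P.eta_coe _) (P.eta_coe _)]

theorem trace_add (B B' : V → V → ℝ) :
    P.trace (fun x y ↦ B x y + B' x y) = P.trace B + P.trace B' := by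
  simp [trace, traceWith, mul_add, Finset.sum_add_distrib]

theorem trace_const_mul (c : ℝ) (B : V → V → ℝ) :
    P.trace (fun x y ↦ c * B x y) = c * P.trace B := by
  simp [trace, traceWith, Finset.mul_sum, mul_left_comm]

theorem trace_neg (B : V → V → ℝ) : P.trace (fun x y ↦ -B x y) = -P.trace B := by
  simpa using P.trace_const_mul (-1) B

theorem trace_sub (B B' : V → V → ℝ) :
    P.trace (fun x y ↦ B x y - B' x y) = P.trace B - P.trace B' := by
  simp [trace, traceWith, mul_sub, Finset.sum_sub_distrib]

theorem trace_zero : P.trace (fun _ _ ↦ 0) = 0 := by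
  simp [trace, traceWith]

theorem trace_flip (B : V → V → ℝ) : P.trace (fun x y ↦ B y x) = P.trace B :=
  P.traceWith_flip _ B

theorem trace_eq_zero_of_alt {B : V → V → ℝ}
    (h : ∀ x y, P.η x = 0 → P.η y = 0 → B x y = -B y x) : P.trace B = 0 := by
  have h1 := P.trace_congr h
  rw [P.trace_neg (fun x y ↦ B y x), P.trace_flip B] at h1
  change P.trace B = _ at h1
  linarith

theorem trace_g : P.trace (fun x y ↦ P.g x y) = 2 * n := by
  have := P.finiteDimensional
  rw [trace, P.traceWith_g, Fintype.card_fin, P.finrank_D]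
  simp

theorem trace_g_mul (α : V →ₗ[ℝ] ℝ) (z : V) :
    P.trace (fun x y ↦ P.g x z * α y) = α (P.φ (P.φ z)) := by
  have := P.finiteDimensional
  rw [← P.traceWith_g_mul (Module.finBasis ℝ P.D) α ⟨P.φ (P.φ z), P.eta_phi _⟩]
  refine P.trace_congr fun x y hx _ ↦ ?_
  simp [P.phi_phi z, P.g_xi, hx]

theorem trace_phi_phi (B : V →ₗ[ℝ] V →ₗ[ℝ] ℝ) :
    P.trace (fun x y ↦ B (P.φ x) (P.φ y)) = -P.trace (fun x y ↦ B x y) := by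
  have := P.finiteDimensional
  let e := Module.finBasis ℝ P.D
  rw [P.trace_eq_traceWith (e.map P.phiD) B]
  have hG : (Matrix.of fun k l ↦ P.g (e.map P.phiD k) (e.map P.phiD l)) = -P.gram e := by
    ext k l
    simp [coe_phiD, gram_apply, P.g_phi_phi]
  have hI : (-P.gram e)⁻¹ = -(P.gram e)⁻¹ := by
    refine Matrix.inv_eq_left_inv ?_
    rw [neg_mul_neg, Matrix.nonsing_inv_mul _ (P.isUnit_det_gram e)]
  simp only [trace, traceWith, hG, hI]
  simp [coe_phiD, gram, e]

theorem trace_g_phi : P.trace (fun x y ↦ P.g x (P.φ y)) = 0 :=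
  P.trace_eq_zero_of_alt fun x y _ _ ↦ by rw [← P.g_phi_left, P.g_symm]

theorem trace_g_phi_phi : P.trace (fun x y ↦ P.g (P.φ x) (P.φ y)) = -(2 * n) := by
  rw [P.trace_phi_phi P.g, P.trace_g]

end AlmostParacontactMetricSpace

namespace AlmostParacontactMetricSpace

variable {n : ℕ} {V : Type*} [AddCommGroup V] [Module ℝ V]
  (P : AlmostParacontactMetricSpace n V)

/-- `θ_F` as a linear functional. -/
noncomputable def thetaHom (F : V →ₗ[ℝ] V →ₗ[ℝ] V →ₗ[ℝ] ℝ) : V →ₗ[ℝ] ℝ where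
  toFun := P.theta F
  map_add' z w := by simp only [theta, map_add, trace_add]
  map_smul' c z := by simp only [theta, map_smul, smul_eq_mul, trace_const_mul, RingHom.id_apply]

theorem thetaHom_apply (F : V →ₗ[ℝ] V →ₗ[ℝ] V →ₗ[ℝ] ℝ) (z : V) : P.thetaHom F z = P.theta F z :=
  rfl

theorem theta_map_zero (F : V →ₗ[ℝ] V →ₗ[ℝ] V →ₗ[ℝ] ℝ) : P.theta F 0 = 0 :=
  map_zero (P.thetaHom F)

section structureTensors

variable {P} {F : V →ₗ[ℝ] V →ₗ[ℝ] V →ₗ[ℝ] ℝ}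

theorem structureTensors_self (hF : F ∈ P.structureTensors) (x y : V) : F x y y = 0 := by
  linarith [hF.1 x y y]

theorem structureTensors_phi_right (hF : F ∈ P.structureTensors) (x y z : V) :
    F x y (P.φ z) = F x (P.φ y) z - P.η z * F x (P.φ y) P.ξ - P.η y * F x (P.φ z) P.ξ := by
  have h := hF.2 x y (P.φ z)
  rw [P.phi_phi z, P.eta_phi, map_sub, map_smul, smul_eq_mul] at h
  linarith

end structureTensors

/-- The structure tensors with vanishing `N - 2 dη ⊗ ξ`, described by one symmetry of `F`. -/
def normalTensors : Submodule ℝ (V →ₗ[ℝ] V →ₗ[ℝ] V →ₗ[ℝ] ℝ) where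
  carrier := {F | F ∈ P.structureTensors ∧
    ∀ x y z, F (P.φ x) (P.φ y) z = -F x y z + P.η y * F x P.ξ z}
  zero_mem' := ⟨zero_mem _, by simp⟩
  add_mem' := by
    rintro F F' ⟨h0, h1⟩ ⟨h0', h1'⟩
    refine ⟨add_mem h0 h0', fun x y z ↦ ?_⟩
    simp only [LinearMap.add_apply]
    linear_combination h1 x y z + h1' x y z
  smul_mem' := by
    rintro c F ⟨h0, h1⟩
    refine ⟨Submodule.smul_mem _ c h0, fun x y z ↦ ?_⟩
    simp only [LinearMap.smul_apply, smul_eq_mul]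
    linear_combination c * h1 x y z

/-- The tensor `g(N(x, y) - 2 dη(x, y) ξ, z)` expressed in terms of `F`. -/
def normalityTensor (F : V →ₗ[ℝ] V →ₗ[ℝ] V →ₗ[ℝ] ℝ) (x y z : V) : ℝ :=
  F (P.φ x) y z - F (P.φ y) x z + F x y (P.φ z) - F y x (P.φ z)
    + P.η z * (F x (P.φ y) P.ξ - F y (P.φ x) P.ξ)

/-- A trilinear form that is symmetric in the first pair and alternating in the second pair of
arguments vanishes. -/
theorem eq_zero_of_symm_of_alt {α : Type*} {A : α → α → α → ℝ}
    (hs : ∀ x y z, A x y z = A y x z) (ha : ∀ x y z, A x y z = -A x z y) (x y z : α) :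
    A x y z = 0 := by
  linarith [hs x y z, ha y x z, hs y z x, ha z y x, hs z x y, ha x z y]

section normal

variable {P} {F : V →ₗ[ℝ] V →ₗ[ℝ] V →ₗ[ℝ] ℝ}

theorem normalityTensor_eq_zero (hF : F ∈ P.normalTensors) (x y z : V) :
    P.normalityTensor F x y z = 0 := by
  obtain ⟨h0, h1⟩ := hF
  have key : ∀ x y z, F (P.φ x) y z + F x (P.φ y) z + P.η y * F (P.φ x) z P.ξ = 0 := by
    intro x y z
    have h := h1 x (P.φ y) z
    rw [P.phi_phi y, P.eta_phi, map_sub, map_smul] at h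
    simp only [LinearMap.sub_apply, LinearMap.smul_apply, smul_eq_mul] at h
    linear_combination h + P.η y * h0.1 (P.φ x) z P.ξ
  have k1 := key x y z
  have k2 := key y x z
  have k3 := key x z P.ξ
  have k4 := key y z P.ξ
  rw [structureTensors_self h0, mul_zero] at k3 k4
  unfold normalityTensor
  rw [structureTensors_phi_right h0, structureTensors_phi_right h0]
  linear_combination k1 - k2 - P.η y * k3 + P.η x * k4

theorem mem_normalTensors_of_normalityTensor (h0 : F ∈ P.structureTensors)
    (hT : ∀ x y z, P.normalityTensor F x y z = 0) : F ∈ P.normalTensors := by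
  have sym : ∀ x y z, F (P.φ x) y z + F x (P.φ y) z - P.η y * F x (P.φ z) P.ξ =
      F (P.φ y) x z + F y (P.φ x) z - P.η x * F y (P.φ z) P.ξ := by
    intro x y z
    have h := hT x y z
    unfold normalityTensor at h
    rw [structureTensors_phi_right h0, structureTensors_phi_right h0] at h
    linear_combination h
  have xi_xi : ∀ x, F x P.ξ P.ξ = 0 := fun x ↦ structureTensors_self h0 _ _
  have hor : ∀ x y z : P.D, F (P.φ x) y z + F x (P.φ y) z = 0 := by
    intro x y z
    refine eq_zero_of_symm_of_alt (A := fun x y z : P.D ↦ F (P.φ x) y z + F x (P.φ y) z)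
      (fun x y z ↦ ?_) (fun x y z ↦ ?_) x y z
    · simpa [P.eta_coe] using sym x y z
    · have h := structureTensors_phi_right h0 x y z
      simp only [P.eta_coe, zero_mul, sub_zero] at h
      linear_combination h0.1 (P.φ x) y z - h + h0.1 x y (P.φ z)
  have hbs : ∀ x y : V, P.η x = 0 → P.η y = 0 → F (P.φ x) y P.ξ + F x (P.φ y) P.ξ =
      F (P.φ y) x P.ξ + F y (P.φ x) P.ξ := by
    intro x y hx hy
    simpa [hx, hy, P.phi_xi] using sym x y P.ξ
  have hxi : ∀ y z : V, P.η y = 0 → P.η z = 0 →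
      F P.ξ (P.φ y) z = -(F (P.φ y) z P.ξ + F y (P.φ z) P.ξ) := by
    intro y z hy hz
    have h := sym P.ξ y z
    simp only [P.phi_xi, map_zero, LinearMap.zero_apply, hy, P.eta_xi] at h
    linear_combination h + h0.1 (P.φ y) P.ξ z
  have hxi_alt : ∀ y z : V, P.η y = 0 → P.η z = 0 → F P.ξ (P.φ y) z = -F P.ξ (P.φ z) y := by
    intro y z hy hz
    have h := structureTensors_phi_right h0 P.ξ y z
    simp only [hy, hz, zero_mul, sub_zero] at h
    rw [← h, h0.1]
  have hxi0 : ∀ y z : V, P.η y = 0 → P.η z = 0 → F P.ξ (P.φ y) z = 0 := by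
    intro y z hy hz
    linarith [hxi y z hy hz, hxi z y hz hy, hbs y z hy hz, hxi_alt y z hy hz]
  have hb : ∀ x y : V, P.η x = 0 → P.η y = 0 → F (P.φ x) y P.ξ + F x (P.φ y) P.ξ = 0 := by
    intro x y hx hy
    linarith [hxi x y hx hy, hxi0 x y hx hy]
  have hxixi : ∀ y : V, F P.ξ (P.φ y) P.ξ = 0 := by
    intro y
    have h := sym P.ξ y P.ξ
    simpa [P.phi_xi, xi_xi] using h
  refine ⟨h0, fun x y z ↦ ?_⟩
  have dec : ∀ u : V, u = P.φ (P.φ u) + P.η u • P.ξ := fun u ↦ by simp [P.phi_phi]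
  have hx : F x y z = F (P.φ (P.φ x)) y z + P.η x * F P.ξ y z := by
    conv_lhs => rw [dec x]
    simp
  have hx' : F x P.ξ z = F (P.φ (P.φ x)) P.ξ z + P.η x * F P.ξ P.ξ z := by
    conv_lhs => rw [dec x]
    simp
  have hy : ∀ x z, F x y z = F x (P.φ (P.φ y)) z + P.η y * F x P.ξ z := fun x z ↦ by
    conv_lhs => rw [dec y]
    simp
  have hz : ∀ x y, F x y z = F x y (P.φ (P.φ z)) + P.η z * F x y P.ξ := fun x y ↦ by
    conv_lhs => rw [dec z]
    simp
  have e := P.eta_phi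
  have a1 := hor ⟨_, e x⟩ ⟨_, e (P.φ y)⟩ ⟨_, e (P.φ z)⟩
  have a2 := hb _ _ (e x) (e (P.φ y))
  have a3 := hxi0 _ _ (e y) (e (P.φ z))
  have a4 := hxixi (P.φ y)
  simp only [P.phi_phi_phi] at a1 a2
  rw [hx, hx', hy, hz (P.φ x), hz (P.φ (P.φ x)) (P.φ (P.φ y)), hy P.ξ z, hz P.ξ (P.φ (P.φ y))]
  linear_combination a1 + P.η z * a2 + P.η x * a3 + P.η x * P.η z * a4

end normal

/-! ### The classes consist of normal tensors -/

theorem G₁_le_normalTensors : P.G₁ ≤ P.normalTensors := by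
  rintro F ⟨h0, h1⟩
  refine ⟨h0, fun x y z ↦ ?_⟩
  rw [h1 (P.φ x), h1 x y, h1 x P.ξ]
  simp only [h, P.phi_xi, map_zero, P.phi_phi_phi, theta_map_zero, P.g_phi_phi, P.eta_phi,
    P.g_phi_left]
  ring

theorem G₂_le_normalTensors : P.G₂ ≤ P.normalTensors := by
  rintro F ⟨h0, h1, -⟩
  refine ⟨h0, fun x y z ↦ ?_⟩
  have h := h1 x P.ξ z
  rw [P.phi_xi, map_zero, LinearMap.zero_apply] at h
  rw [h1]
  linear_combination -P.η y * h

section vertical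

variable {P} {F : V →ₗ[ℝ] V →ₗ[ℝ] V →ₗ[ℝ] ℝ}

theorem mem_normalTensors_of_vertical (h0 : F ∈ P.structureTensors)
    (h1 : ∀ x y z, F x y z = -(P.η y * F x z P.ξ) + P.η z * F x y P.ξ)
    (h2 : ∀ x y, F x y P.ξ = -F (P.φ x) (P.φ y) P.ξ) : F ∈ P.normalTensors := by
  refine ⟨h0, fun x y z ↦ ?_⟩
  rw [h1 (P.φ x), h1 x y z, h1 x P.ξ z, P.eta_phi, P.eta_xi, structureTensors_self h0, h2 x y]
  ring

theorem G₅_apply_xi (hF : F ∈ P.G₅) (x y : V) :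
    F x y P.ξ = -(P.theta F P.ξ / (2 * n)) * P.g (P.φ x) (P.φ y) := by
  rw [hF.2 x y P.ξ, P.phi_xi, P.eta_xi, map_zero]
  ring

theorem G₅_apply (hF : F ∈ P.G₅) (x y z : V) :
    F x y z = -(P.η y * F x z P.ξ) + P.η z * F x y P.ξ := by
  rw [G₅_apply_xi hF, G₅_apply_xi hF, hF.2]
  ring

theorem G₆_apply_xi (hF : F ∈ P.G₆) (x y : V) :
    F x y P.ξ = P.thetaStar F P.ξ / (2 * n) * P.g x (P.φ y) := by
  rw [hF.2 x y P.ξ, P.phi_xi, P.eta_xi, map_zero]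
  ring

theorem G₆_apply (hF : F ∈ P.G₆) (x y z : V) :
    F x y z = -(P.η y * F x z P.ξ) + P.η z * F x y P.ξ := by
  rw [G₆_apply_xi hF, G₆_apply_xi hF, hF.2]
  ring

end vertical

theorem G₅_le_normalTensors : P.G₅ ≤ P.normalTensors := by
  refine fun F hF ↦ mem_normalTensors_of_vertical hF.1 (G₅_apply hF) fun x y ↦ ?_
  rw [G₅_apply_xi hF, G₅_apply_xi hF, P.g_phi_phi (P.φ x), P.eta_phi]
  ring

theorem G₆_le_normalTensors : P.G₆ ≤ P.normalTensors := by
  refine fun F hF ↦ mem_normalTensors_of_vertical hF.1 (G₆_apply hF) fun x y ↦ ?_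
  rw [G₆_apply_xi hF, G₆_apply_xi hF, P.g_phi_phi x, P.eta_phi]
  ring

theorem G₇_le_normalTensors : P.G₇ ≤ P.normalTensors :=
  fun _ hF ↦ mem_normalTensors_of_vertical hF.1 hF.2.1 hF.2.2.2.1

theorem G₈_le_normalTensors : P.G₈ ≤ P.normalTensors :=
  fun _ hF ↦ mem_normalTensors_of_vertical hF.1 hF.2.1 hF.2.2.2.1

end AlmostParacontactMetricSpace

theorem BasicClass.subspace_le_normalTensors {n : ℕ} {V : Type*} [AddCommGroup V] [Module ℝ V]
    (P : AlmostParacontactMetricSpace n V) (i : BasicClass) : i.subspace P ≤ P.normalTensors := by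
  cases i
  exacts [P.G₁_le_normalTensors, P.G₂_le_normalTensors, P.G₅_le_normalTensors,
    P.G₆_le_normalTensors, P.G₇_le_normalTensors, P.G₈_le_normalTensors]

namespace AlmostParacontactMetricSpace

variable {n : ℕ} {V : Type*} [AddCommGroup V] [Module ℝ V]
  (P : AlmostParacontactMetricSpace n V)

/-! ### Decomposition of a normal tensor -/

/-- The trilinear form `-η(y) b(x, z) + η(z) b(x, y)`. -/
def vertical (b : V →ₗ[ℝ] V →ₗ[ℝ] ℝ) : V →ₗ[ℝ] V →ₗ[ℝ] V →ₗ[ℝ] ℝ :=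
  LinearMap.mk₂ ℝ (fun x y ↦ b x y • P.η - P.η y • b x)
    (by intros; ext; simp; ring) (by intros; ext; simp; ring)
    (by intros; ext; simp; ring) (by intros; ext; simp; ring)

theorem vertical_apply (b : V →ₗ[ℝ] V →ₗ[ℝ] ℝ) (x y z : V) :
    P.vertical b x y z = b x y * P.η z - P.η y * b x z := rfl

/-- The trilinear form
`g(x, φy) θ(φz) - g(x, φz) θ(φy) - g(φx, φy) θ(hz) + g(φx, φz) θ(hy)`. -/
def horizontal (θ : V →ₗ[ℝ] ℝ) : V →ₗ[ℝ] V →ₗ[ℝ] V →ₗ[ℝ] ℝ :=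
  LinearMap.mk₂ ℝ (fun x y ↦ P.g x (P.φ y) • θ ∘ₗ P.φ - θ (P.φ y) • P.g x ∘ₗ P.φ
      - P.g (P.φ x) (P.φ y) • θ ∘ₗ P.φ ∘ₗ P.φ + θ (P.φ (P.φ y)) • P.g (P.φ x) ∘ₗ P.φ)
    (by intros; ext; simp; ring) (by intros; ext; simp; ring)
    (by intros; ext; simp; ring) (by intros; ext; simp; ring)

theorem horizontal_apply (θ : V →ₗ[ℝ] ℝ) (x y z : V) : P.horizontal θ x y z =
    P.g x (P.φ y) * θ (P.φ z) - θ (P.φ y) * P.g x (P.φ z)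
      - P.g (P.φ x) (P.φ y) * θ (P.h z) + θ (P.h y) * P.g (P.φ x) (P.φ z) := rfl

theorem horizontal_mem_structureTensors (θ : V →ₗ[ℝ] ℝ) :
    P.horizontal θ ∈ P.structureTensors := by
  refine ⟨fun x y z ↦ ?_, fun x y z ↦ ?_⟩
  · simp only [horizontal_apply]
    ring
  · simp only [horizontal_apply, h, P.phi_xi, map_zero, P.phi_phi_phi]
    rw [P.g_phi_phi x (P.φ z), P.g_phi_phi x (P.φ y), P.eta_phi, P.eta_phi]
    have h1 : ∀ w, P.g x (P.φ (P.φ w)) = -P.g (P.φ x) (P.φ w) := fun w ↦ by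
      rw [P.g_phi_left, neg_neg]
    rw [h1, h1]
    ring

theorem theta_horizontal (θ : V →ₗ[ℝ] ℝ) (z : V) :
    P.theta (P.horizontal θ) z = 2 * ((n : ℝ) - 1) * θ (P.h z) := by
  have h1 : P.trace (fun x y ↦ P.horizontal θ x y z) = P.trace (fun x y ↦
      θ (P.φ z) * P.g x (P.φ y) - P.g x (P.φ z) * (θ ∘ₗ P.φ) y
        - θ (P.h z) * P.g (P.φ x) (P.φ y) - P.g x z * θ y) := by
    refine P.trace_congr fun x y hx hy ↦ ?_
    simp only [horizontal_apply, h, P.phi_phi_of_eta_eq_zero hy, P.g_phi_phi x z, hx,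
      LinearMap.comp_apply]
    ring
  rw [theta, h1, P.trace_sub, P.trace_sub, P.trace_sub, P.trace_const_mul, P.trace_const_mul,
    P.trace_g_phi, P.trace_g_mul, P.trace_g_phi_phi, P.trace_g_mul, LinearMap.comp_apply,
    P.phi_phi_phi]
  simp only [h]
  ring

theorem vertical_mem_structureTensors {b : V →ₗ[ℝ] V →ₗ[ℝ] ℝ} (hb : ∀ x, b x P.ξ = 0) :
    P.vertical b ∈ P.structureTensors := by
  refine ⟨fun x y z ↦ ?_, fun x y z ↦ ?_⟩
  · simp only [vertical_apply]
    ring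
  · simp only [vertical_apply, P.eta_phi, P.eta_xi, hb]
    ring

theorem vertical_apply_xi {b : V →ₗ[ℝ] V →ₗ[ℝ] ℝ} (hb : ∀ x, b x P.ξ = 0) (x y : V) :
    P.vertical b x y P.ξ = b x y := by
  simp [vertical_apply, hb, P.eta_xi]

theorem vertical_apply_eq {b : V →ₗ[ℝ] V →ₗ[ℝ] ℝ} (hb : ∀ x, b x P.ξ = 0) (x y z : V) :
    P.vertical b x y z =
      -(P.η y * P.vertical b x z P.ξ) + P.η z * P.vertical b x y P.ξ := by
  rw [P.vertical_apply_xi hb, P.vertical_apply_xi hb, vertical_apply]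
  ring

theorem theta_vertical (b : V →ₗ[ℝ] V →ₗ[ℝ] ℝ) (z : V) :
    P.theta (P.vertical b) z = P.η z * P.trace (fun x y ↦ b x y) := by
  rw [theta, ← P.trace_const_mul]
  refine P.trace_congr fun x y _ hy ↦ ?_
  rw [vertical_apply, hy]
  ring

theorem vertical_add (b c : V →ₗ[ℝ] V →ₗ[ℝ] ℝ) :
    P.vertical (b + c) = P.vertical b + P.vertical c := by
  ext x y z
  simp [vertical_apply]
  ring

/-- The form `g(x, φy)`. -/
def fundamentalForm : V →ₗ[ℝ] V →ₗ[ℝ] ℝ := P.g.compl₂ P.φ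

theorem fundamentalForm_apply (x y : V) : P.fundamentalForm x y = P.g x (P.φ y) := rfl

/-- The form `g(φx, φy)`. -/
def phiMetric : V →ₗ[ℝ] V →ₗ[ℝ] ℝ := P.g.compl₁₂ P.φ P.φ

theorem phiMetric_apply (x y : V) : P.phiMetric x y = P.g (P.φ x) (P.φ y) := rfl

section trace_of_anti_invariant

variable {P} {b : V → V → ℝ}

theorem apply_phi_of_anti_invariant (hb : ∀ x y, b x y = -b (P.φ x) (P.φ y)) {x y : V}
    (hx : P.η x = 0) : b (P.φ x) y = -b x (P.φ y) := by
  rw [hb (P.φ x), P.phi_phi_of_eta_eq_zero hx]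

theorem trace_phi_of_symm (hb : ∀ x y, b x y = -b (P.φ x) (P.φ y)) (hs : ∀ x y, b x y = b y x) :
    P.trace (fun x y ↦ b x (P.φ y)) = 0 :=
  P.trace_eq_zero_of_alt fun x y _ hy ↦ by rw [hs, apply_phi_of_anti_invariant hb hy]

end trace_of_anti_invariant

theorem vertical_mem_G₅ (hn : n ≠ 0) (c : ℝ) : P.vertical (c • P.phiMetric) ∈ P.G₅ := by
  have hb : ∀ x, (c • P.phiMetric) x P.ξ = 0 := fun x ↦ by simp [phiMetric_apply, P.phi_xi]
  have hn' : (n : ℝ) ≠ 0 := by exact_mod_cast hn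
  refine ⟨P.vertical_mem_structureTensors hb, fun x y z ↦ ?_⟩
  have ht : P.trace (fun x y ↦ (c • P.phiMetric) x y) = -(2 * n * c) := by
    simp only [LinearMap.smul_apply, smul_eq_mul]
    rw [P.trace_const_mul c (fun x y ↦ P.phiMetric x y)]
    simp only [phiMetric_apply, P.trace_g_phi_phi]
    ring
  rw [theta_vertical, ht, P.eta_xi, vertical_apply]
  simp only [LinearMap.smul_apply, smul_eq_mul, phiMetric_apply]
  field_simp
  ring

theorem vertical_mem_G₆ (hn : n ≠ 0) (c : ℝ) : P.vertical (c • P.fundamentalForm) ∈ P.G₆ := by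
  have hb : ∀ x, (c • P.fundamentalForm) x P.ξ = 0 := fun x ↦ by
    simp [fundamentalForm_apply, P.phi_xi]
  have hn' : (n : ℝ) ≠ 0 := by exact_mod_cast hn
  refine ⟨P.vertical_mem_structureTensors hb, fun x y z ↦ ?_⟩
  have ht : P.thetaStar (P.vertical (c • P.fundamentalForm)) P.ξ = 2 * n * c := by
    have h1 : ∀ x y, P.η x = 0 → P.η y = 0 →
        P.vertical (c • P.fundamentalForm) x (P.φ y) P.ξ = c * P.g x y := fun x y _ hy ↦ by
      rw [P.vertical_apply_xi hb]
      simp [fundamentalForm_apply, P.phi_phi_of_eta_eq_zero hy]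
    rw [thetaStar, P.trace_congr h1, P.trace_const_mul c (fun x y ↦ P.g x y), P.trace_g]
    ring
  rw [ht, vertical_apply]
  simp only [LinearMap.smul_apply, smul_eq_mul, fundamentalForm_apply]
  field_simp
  ring

theorem vertical_mem_G₇ {b : V →ₗ[ℝ] V →ₗ[ℝ] ℝ} (h1 : ∀ x, b x P.ξ = 0)
    (h2 : ∀ x y, b x y = -b y x) (h3 : ∀ x y, b x y = -b (P.φ x) (P.φ y))
    (h4 : P.trace (fun x y ↦ b x (P.φ y)) = 0) : P.vertical b ∈ P.G₇ := by
  refine ⟨P.vertical_mem_structureTensors h1, P.vertical_apply_eq h1, ?_, ?_, ?_⟩ <;>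
    simpa only [P.vertical_apply_xi h1, thetaStar]

theorem vertical_mem_G₈ {b : V →ₗ[ℝ] V →ₗ[ℝ] ℝ} (h1 : ∀ x, b x P.ξ = 0)
    (h2 : ∀ x y, b x y = b y x) (h3 : ∀ x y, b x y = -b (P.φ x) (P.φ y))
    (h4 : P.trace (fun x y ↦ b x y) = 0) : P.vertical b ∈ P.G₈ := by
  refine ⟨P.vertical_mem_structureTensors h1, P.vertical_apply_eq h1, ?_, ?_, ?_⟩ <;>
    simpa only [P.vertical_apply_xi h1, theta]

theorem phiMetric_phi (x y : V) : P.phiMetric x y = -P.phiMetric (P.φ x) (P.φ y) := by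
  rw [phiMetric_apply, phiMetric_apply, P.g_phi_phi (P.φ x), P.eta_phi]
  ring

theorem fundamentalForm_phi (x y : V) :
    P.fundamentalForm x y = -P.fundamentalForm (P.φ x) (P.φ y) := by
  rw [fundamentalForm_apply, fundamentalForm_apply, P.g_phi_phi x, P.eta_phi]
  ring

theorem fundamentalForm_swap (x y : V) : P.fundamentalForm x y = -P.fundamentalForm y x := by
  rw [fundamentalForm_apply, fundamentalForm_apply, ← P.g_phi_left, P.g_symm]

theorem vertical_mem_sup (hn : n ≠ 0) {b : V →ₗ[ℝ] V →ₗ[ℝ] ℝ} (h1 : ∀ x, b x P.ξ = 0)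
    (h3 : ∀ x y, b x y = -b (P.φ x) (P.φ y)) :
    P.vertical b ∈ P.G₅ ⊔ P.G₆ ⊔ P.G₇ ⊔ P.G₈ := by
  have hn' : (n : ℝ) ≠ 0 := by exact_mod_cast hn
  have h1' : ∀ x, b P.ξ x = 0 := fun x ↦ by rw [h3, P.phi_xi]; simp
  set s := P.trace (fun x y ↦ b x y) with hs
  set t := P.trace (fun x y ↦ b x (P.φ y)) with ht
  have hts : P.trace (fun x y ↦ b y x) = s := P.trace_flip _
  have htt : P.trace (fun x y ↦ b (P.φ y) x) = -t := by
    rw [P.trace_flip (fun x y ↦ b (P.φ x) y), ht, ← P.trace_neg]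
    exact P.trace_congr fun x y hx _ ↦ apply_phi_of_anti_invariant (b := fun x y ↦ b x y) h3 hx
  let b₅ := (-(s / (2 * n))) • P.phiMetric
  let b₆ := (t / (2 * n)) • P.fundamentalForm
  let b₇ := (1 / 2 : ℝ) • (b - b.flip) - b₆
  let b₈ := (1 / 2 : ℝ) • (b + b.flip) - b₅
  have e₅ : ∀ x y, b₅ x y = -(s / (2 * n)) * P.phiMetric x y := fun x y ↦ rfl
  have e₆ : ∀ x y, b₆ x y = t / (2 * n) * P.fundamentalForm x y := fun x y ↦ rfl
  have e₇ : ∀ x y, b₇ x y = 1 / 2 * (b x y - b y x) - t / (2 * n) * P.fundamentalForm x y :=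
    fun x y ↦ rfl
  have e₈ : ∀ x y, b₈ x y = 1 / 2 * (b x y + b y x) - -(s / (2 * n)) * P.phiMetric x y :=
    fun x y ↦ rfl
  have hb : b = b₅ + b₆ + b₇ + b₈ := by
    ext x y
    simp only [LinearMap.add_apply, e₅, e₆, e₇, e₈]
    ring
  have hm : ∀ x, P.phiMetric x P.ξ = 0 := fun x ↦ by simp [phiMetric_apply, P.phi_xi]
  have hf : ∀ x, P.fundamentalForm x P.ξ = 0 := fun x ↦ by
    simp [fundamentalForm_apply, P.phi_xi]
  rw [hb, vertical_add, vertical_add, vertical_add]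
  refine Submodule.add_mem_sup (Submodule.add_mem_sup (Submodule.add_mem_sup
    (P.vertical_mem_G₅ hn _) (P.vertical_mem_G₆ hn _)) ?_) ?_
  · refine P.vertical_mem_G₇ (fun x ↦ ?_) (fun x y ↦ ?_) (fun x y ↦ ?_) ?_
    · rw [e₇, h1, h1', hf]
      ring
    · rw [e₇, e₇, P.fundamentalForm_swap x y]
      ring
    · rw [e₇, e₇, P.fundamentalForm_phi x y, h3 x, h3 y]
      ring
    · have h : ∀ x y, P.η x = 0 → P.η y = 0 → b₇ x (P.φ y) =
          1 / 2 * (b x (P.φ y) - b (P.φ y) x) - t / (2 * n) * P.g x y := fun x y _ hy ↦ by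
        rw [e₇, fundamentalForm_apply, P.phi_phi_of_eta_eq_zero hy]
      rw [P.trace_congr h, P.trace_sub, P.trace_const_mul, P.trace_const_mul, P.trace_sub, htt,
        P.trace_g, ← ht]
      field_simp
      ring
  · refine P.vertical_mem_G₈ (fun x ↦ ?_) (fun x y ↦ ?_) (fun x y ↦ ?_) ?_
    · rw [e₈, h1, h1', hm]
      ring
    · rw [e₈, e₈, phiMetric_apply, phiMetric_apply, P.g_symm]
      ring
    · rw [e₈, e₈, P.phiMetric_phi x y, h3 x, h3 y]
      ring
    · simp only [e₈, phiMetric_apply]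
      rw [P.trace_sub, P.trace_const_mul, P.trace_const_mul, P.trace_add, hts,
        P.trace_g_phi_phi, ← hs]
      field_simp
      ring

theorem exists_g_self_ne_zero (hn : n ≠ 0) : ∃ u, P.η u = 0 ∧ P.g u u ≠ 0 := by
  by_contra! hg
  have h2 := P.trace_g
  rw [P.trace_congr (B' := fun _ _ ↦ 0) fun x y hx hy ↦ ?_, P.trace_zero] at h2
  · have : (n : ℝ) ≠ 0 := by exact_mod_cast hn
    exact this (by linarith)
  · have := hg (x + y) (by simp [hx, hy])
    simp only [map_add, LinearMap.add_apply, hg x hx, hg y hy, P.g_symm y x] at this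
    linarith

/-- In dimension three a structure tensor that is horizontal in the last two arguments is zero. -/
theorem eq_zero_of_horizontal_of_dim_three (hn : n = 1) {F : V →ₗ[ℝ] V →ₗ[ℝ] V →ₗ[ℝ] ℝ}
    (hF : F ∈ P.structureTensors) (h1 : ∀ x y, F x y P.ξ = 0) : F = 0 := by
  obtain ⟨u, hu, hg⟩ := P.exists_g_self_ne_zero (by omega)
  let w : Fin 2 → P.D := ![⟨u, hu⟩, ⟨P.φ u, P.eta_phi u⟩]
  have hw : LinearIndependent ℝ w := by
    rw [LinearIndependent.pair_iff]
    intro s t hst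
    have hst' : s • u + t • P.φ u = 0 := congrArg (Submodule.subtype P.D) hst
    have hs := congrArg (P.g u) hst'
    have ht := congrArg (P.g (P.φ u)) hst'
    simp only [map_add, map_smul, smul_eq_mul, P.g_phi_self, P.g_phi_left u u, P.g_phi_phi u u, hu,
      map_zero] at hs ht
    exact ⟨by simpa [hg] using hs, by simpa [hg] using ht⟩
  have := P.finiteDimensional
  let e := basisOfLinearIndependentOfCardEqFinrank hw (by rw [P.finrank_D, hn]; simp)
  have he : ∀ i, e i = w i := fun i ↦ by simp [e]
  have huu : ∀ x, F x u (P.φ u) = 0 := fun x ↦ by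
    have h := hF.2 x u (P.φ u)
    rw [P.phi_phi_of_eta_eq_zero hu, h1, h1] at h
    linarith [hF.1 x u (P.φ u)]
  have hD : ∀ x, (F x).domRestrict₁₂ P.D P.D = 0 := fun x ↦ by
    refine LinearMap.ext_basis e e fun i j ↦ ?_
    rw [he, he]
    change F x (w i) (w j) = 0
    fin_cases i <;> fin_cases j
    · exact structureTensors_self hF _ _
    · exact huu x
    · exact (hF.1 _ _ _).trans (neg_eq_zero.2 (huu x))
    · exact structureTensors_self hF _ _
  ext x y z
  rw [hF.2 x y z, h1, h1]
  have h : F x (P.φ y) (P.φ z) = 0 :=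
    congrArg (fun B : P.D →ₗ[ℝ] P.D →ₗ[ℝ] ℝ ↦ B ⟨_, P.eta_phi y⟩ ⟨_, P.eta_phi z⟩) (hD x)
  simp [h]

set_option maxSynthPendingDepth 6 in
theorem mem_sup_of_horizontal {F : V →ₗ[ℝ] V →ₗ[ℝ] V →ₗ[ℝ] ℝ}
    (hF : F ∈ P.normalTensors) (h1 : ∀ x y, F x y P.ξ = 0) : F ∈ P.G₁ ⊔ P.G₂ := by
  rcases eq_or_ne n 1 with hn | hn
  · rw [P.eq_zero_of_horizontal_of_dim_three hn hF.1 h1]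
    exact zero_mem _
  have hn' : (n : ℝ) - 1 ≠ 0 := sub_ne_zero.2 (by exact_mod_cast hn)
  have hθ : ∀ z, P.theta F (P.h z) = P.theta F z := fun z ↦ by
    have : P.theta F P.ξ = 0 := by simp only [theta, h1, P.trace_zero]
    simp only [← thetaHom_apply, h, P.phi_phi, map_sub, map_smul] at this ⊢
    simp [this]
  let f := (1 / (2 * ((n : ℝ) - 1))) • P.horizontal (P.thetaHom F)
  have hf : ∀ z, P.theta f z = P.theta F z := fun z ↦ by
    rw [theta_smul, theta_horizontal, thetaHom_apply, hθ]
    field_simp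
  have hf₁ : f ∈ P.G₁ := by
    refine ⟨Submodule.smul_mem _ _ (P.horizontal_mem_structureTensors _), fun x y z ↦ ?_⟩
    simp only [hf]
    change 1 / (2 * ((n : ℝ) - 1)) * P.horizontal (P.thetaHom F) x y z = _
    simp only [horizontal_apply, thetaHom_apply]
    ring
  have hsub : F - f ∈ P.normalTensors := sub_mem hF (P.G₁_le_normalTensors hf₁)
  have hf₂ : F - f ∈ P.G₂ := by
    refine ⟨hsub.1, fun x y z ↦ ?_, fun z ↦ ?_⟩
    · have h0 : (F - f) x P.ξ z = 0 := by
        rw [hsub.1.1]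
        have : f x z P.ξ = 0 := by
          change 1 / (2 * ((n : ℝ) - 1)) * P.horizontal (P.thetaHom F) x z P.ξ = 0
          simp [horizontal_apply, h, P.phi_xi]
        simp [h1, this]
      rw [hsub.2, h0]
      ring
    · rw [sub_eq_add_neg, ← neg_one_smul ℝ f, theta_add, theta_smul, hf]
      ring
  rw [← add_sub_cancel f F]
  exact Submodule.add_mem_sup hf₁ hf₂

set_option maxSynthPendingDepth 6 in
theorem normalTensors_le_sup (hn : n ≠ 0) :
    P.normalTensors ≤ P.G₁ ⊔ P.G₂ ⊔ (P.G₅ ⊔ P.G₆ ⊔ P.G₇ ⊔ P.G₈) := by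
  intro F hF
  let b : V →ₗ[ℝ] V →ₗ[ℝ] ℝ := F.compr₂ (LinearMap.applyₗ P.ξ)
  have hb : ∀ x y, b x y = F x y P.ξ := fun x y ↦ rfl
  have h1 : ∀ x, b x P.ξ = 0 := fun x ↦ structureTensors_self hF.1 _ _
  have h3 : ∀ x y, b x y = -b (P.φ x) (P.φ y) := fun x y ↦ by
    rw [hb, hb, hF.2, ← hb x P.ξ, h1]
    ring
  have hv : P.vertical b ∈ P.normalTensors := mem_normalTensors_of_vertical
    (P.vertical_mem_structureTensors h1) (P.vertical_apply_eq h1)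
    (by simpa only [P.vertical_apply_xi h1] using h3)
  rw [← sub_add_cancel F (P.vertical b)]
  refine Submodule.add_mem_sup (P.mem_sup_of_horizontal (sub_mem hF hv) fun x y ↦ ?_)
    (P.vertical_mem_sup hn h1 h3)
  simp [P.vertical_apply_xi h1, hb]

/-! ### Independence of the classes -/

section independence

variable {P} {F : V →ₗ[ℝ] V →ₗ[ℝ] V →ₗ[ℝ] ℝ}

theorem G₁_apply_xi (hF : F ∈ P.G₁) (x y : V) : F x y P.ξ = 0 := by
  rw [hF.2]
  simp [h, P.phi_xi, theta_map_zero]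

theorem G₂_apply_xi (hF : F ∈ P.G₂) (x y : V) : F x y P.ξ = 0 := by
  have h := hF.2.1 x P.ξ y
  rw [P.phi_xi, map_zero, LinearMap.zero_apply] at h
  linarith [hF.1.1 x y P.ξ]

theorem theta_xi_of_apply_xi_eq_zero (hF : ∀ x y, F x y P.ξ = 0) : P.theta F P.ξ = 0 := by
  simp only [theta, hF, P.trace_zero]

theorem thetaStar_xi_of_apply_xi_eq_zero (hF : ∀ x y, F x y P.ξ = 0) :
    P.thetaStar F P.ξ = 0 := by
  simp only [thetaStar, hF, P.trace_zero]

theorem G₅_thetaStar_xi (hF : F ∈ P.G₅) : P.thetaStar F P.ξ = 0 :=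
  trace_phi_of_symm (b := fun x y ↦ F x y P.ξ)
    (fun x y ↦ by
      rw [G₅_apply_xi hF, G₅_apply_xi hF, P.g_phi_phi (P.φ x), P.eta_phi]
      ring)
    fun x y ↦ by rw [G₅_apply_xi hF, G₅_apply_xi hF, P.g_symm]

theorem G₆_apply_xi_swap (hF : F ∈ P.G₆) (x y : V) : F x y P.ξ = -F y x P.ξ := by
  have h : P.g x (P.φ y) = -P.g y (P.φ x) := P.fundamentalForm_swap x y
  rw [G₆_apply_xi hF, G₆_apply_xi hF, h]
  ring

theorem G₆_theta_xi (hF : F ∈ P.G₆) : P.theta F P.ξ = 0 :=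
  P.trace_eq_zero_of_alt fun x y _ _ ↦ G₆_apply_xi_swap hF x y

theorem G₇_theta_xi (hF : F ∈ P.G₇) : P.theta F P.ξ = 0 :=
  P.trace_eq_zero_of_alt fun x y _ _ ↦ hF.2.2.1 x y

theorem G₈_thetaStar_xi (hF : F ∈ P.G₈) : P.thetaStar F P.ξ = 0 :=
  trace_phi_of_symm (b := fun x y ↦ F x y P.ξ) hF.2.2.2.1 hF.2.2.1

end independence

theorem eq_zero_of_sum_eq_zero {F₁ F₂ F₅ F₆ F₇ F₈ : V →ₗ[ℝ] V →ₗ[ℝ] V →ₗ[ℝ] ℝ}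
    (h₁ : F₁ ∈ P.G₁) (h₂ : F₂ ∈ P.G₂) (h₅ : F₅ ∈ P.G₅) (h₆ : F₆ ∈ P.G₆) (h₇ : F₇ ∈ P.G₇)
    (h₈ : F₈ ∈ P.G₈) (hsum : F₁ + F₂ + F₅ + F₆ + F₇ + F₈ = 0) :
    F₁ = 0 ∧ F₂ = 0 ∧ F₅ = 0 ∧ F₆ = 0 ∧ F₇ = 0 ∧ F₈ = 0 := by
  have x₁ := G₁_apply_xi h₁
  have x₂ := G₂_apply_xi h₂
  have hθ := congrArg (fun F ↦ P.theta F P.ξ) hsum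
  have hθs := congrArg (fun F ↦ P.thetaStar F P.ξ) hsum
  simp only [theta_add, thetaStar_add, theta_zero, thetaStar_zero] at hθ hθs
  have z₅ : F₅ = 0 := by
    rw [theta_xi_of_apply_xi_eq_zero x₁, theta_xi_of_apply_xi_eq_zero x₂, G₆_theta_xi h₆,
      G₇_theta_xi h₇, h₈.2.2.2.2] at hθ
    have h : P.theta F₅ P.ξ = 0 := by linarith
    ext x y z
    simp [h₅.2 x y z, h]
  have z₆ : F₆ = 0 := by
    rw [thetaStar_xi_of_apply_xi_eq_zero x₁, thetaStar_xi_of_apply_xi_eq_zero x₂,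
      G₅_thetaStar_xi h₅, G₈_thetaStar_xi h₈, h₇.2.2.2.2] at hθs
    have h : P.thetaStar F₆ P.ξ = 0 := by linarith
    ext x y z
    simp [h₆.2 x y z, h]
  have hsum' : ∀ x y, F₇ x y P.ξ + F₈ x y P.ξ = 0 := fun x y ↦ by
    have h := congrArg (fun F : V →ₗ[ℝ] V →ₗ[ℝ] V →ₗ[ℝ] ℝ ↦ F x y P.ξ) hsum
    simpa [z₅, z₆, x₁, x₂] using h
  have b₇ : ∀ x y, F₇ x y P.ξ = 0 := fun x y ↦ by
    linarith [hsum' x y, hsum' y x, h₇.2.2.1 x y, h₈.2.2.1 x y]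
  have b₈ : ∀ x y, F₈ x y P.ξ = 0 := fun x y ↦ by linarith [hsum' x y, b₇ x y]
  have z₇ : F₇ = 0 := by
    ext x y z
    simp [h₇.2.1 x y z, b₇]
  have z₈ : F₈ = 0 := by
    ext x y z
    simp [h₈.2.1 x y z, b₈]
  simp only [z₅, z₆, z₇, z₈, add_zero] at hsum
  have z₁ : F₁ = 0 := by
    have h : ∀ z, P.theta F₁ z = 0 := fun z ↦ by
      have := congrArg (fun F ↦ P.theta F z) hsum
      simpa [h₂.2.2 z] using this
    ext x y z
    simp [h₁.2 x y z, h]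
  exact ⟨z₁, by simpa [z₁] using hsum, z₅, z₆, z₇, z₈⟩

end AlmostParacontactMetricSpace

namespace BasicClass

instance : Fintype BasicClass where
  elems := ⟨{.G₁, .G₂, .G₅, .G₆, .G₇, .G₈}, by simp⟩
  complete i := by cases i <;> simp

variable {n : ℕ} {V : Type*} [AddCommGroup V] [Module ℝ V]
  (P : AlmostParacontactMetricSpace n V)

set_option maxSynthPendingDepth 6 in
theorem iSupIndep_subspace : iSupIndep fun i : BasicClass ↦ i.subspace P := by
  classical
  rw [iSupIndep_iff_finsetSum_eq_zero_imp_eq_zero]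
  intro s v hv hsum
  let w : BasicClass → V →ₗ[ℝ] V →ₗ[ℝ] V →ₗ[ℝ] ℝ := fun i ↦ if i ∈ s then v i else 0
  have hw : ∀ i, w i ∈ i.subspace P := fun i ↦ by
    by_cases hi : i ∈ s
    · simpa [w, hi] using hv i hi
    · simp [w, hi]
  have hwsum : ∑ i, w i = 0 := by simpa [w, Finset.sum_ite_mem] using hsum
  have hwsum' : w .G₁ + w .G₂ + w .G₅ + w .G₆ + w .G₇ + w .G₈ = 0 := by
    rw [← hwsum]
    simp [Finset.sum, Finset.univ, Fintype.elems, add_assoc]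
  obtain ⟨z₁, z₂, z₅, z₆, z₇, z₈⟩ := P.eq_zero_of_sum_eq_zero (hw .G₁) (hw .G₂) (hw .G₅)
    (hw .G₆) (hw .G₇) (hw .G₈) hwsum'
  intro i hi
  have : w i = 0 := by cases i <;> assumption
  simpa [w, hi] using this

theorem normalTensors_le_iSup (hn : n ≠ 0) : P.normalTensors ≤ ⨆ i : BasicClass, i.subspace P := by
  refine (P.normalTensors_le_sup hn).trans ?_
  have h := le_iSup fun i : BasicClass ↦ i.subspace P
  exact sup_le (sup_le (h .G₁) (h .G₂))
    (sup_le (sup_le (sup_le (h .G₅) (h .G₆)) (h .G₇)) (h .G₈))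

end BasicClass

section extension

variable {E : Type*} [NormedAddCommGroup E] [NormedSpace ℝ E] [FiniteDimensional ℝ E]
  {H : Type*} [TopologicalSpace H] {I : ModelWithCorners ℝ E H}
  {M : Type*} [TopologicalSpace M] [T2Space M] [ChartedSpace H M] [IsManifold I ∞ M]

/-- Every tangent vector is the value of a global smooth vector field. -/
theorem exists_contMDiffSection_apply_eq {p : M} (v : TangentSpace I p) :
    ∃ X : Cₛ^∞⟮I; E, (TangentSpace I : M → Type _)⟯, X p = v := by
  obtain ⟨s, hs, hX⟩ := FiberBundle.exists_contMDiffOn_extend (k := ∞) I E v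
  obtain ⟨f, -, hf⟩ := (SmoothBumpFunction.nhds_basis_tsupport (I := I) p).mem_iff.1
    (interior_mem_nhds.2 hs)
  refine ⟨⟨(f : M → ℝ) • FiberBundle.extend E v, ?_⟩, ?_⟩
  · exact ContMDiffOn.smul_section_of_tsupport f.contMDiff.contMDiffOn isOpen_interior hf
      (hX.mono interior_subset)
  · change f p • FiberBundle.extend E v p = v
    simp

end extension

section differentiable

variable {E : Type*} [NormedAddCommGroup E] [NormedSpace ℝ E]
  {H : Type*} [TopologicalSpace H] {I : ModelWithCorners ℝ E H}
  {M : Type*} [TopologicalSpace M] [ChartedSpace H M] [IsManifold I ∞ M]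

/-- Differentiability of a vector field at a point. -/
abbrev VectorFieldDifferentiableAt (X : Π q : M, TangentSpace I q) (p : M) : Prop :=
  MDiffAt (T% X) p

theorem exists_vectorFieldDifferentiableAt_apply_eq {p : M} (v : TangentSpace I p) :
    ∃ X : Π q : M, TangentSpace I q, VectorFieldDifferentiableAt X p ∧ X p = v :=
  ⟨_, FiberBundle.mdifferentiableAt_extend I E v, by simp⟩

end differentiable

theorem AlmostParacontactMetricSpace.g_phi_sub_combination {n : ℕ} {V : Type*} [AddCommGroup V]
    [Module ℝ V] (P : AlmostParacontactMetricSpace n V) (a₁ a₂ a₃ a₄ a₅ a₆ a₇ a₈ z : V) :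
    P.g (P.φ (P.φ (a₁ - a₂)) + (a₇ - a₈) - P.φ (a₃ - a₆) - P.φ (a₅ - a₄)) z =
      P.g a₇ z + P.g a₃ (P.φ z) - (P.g a₈ z + P.g a₄ (P.φ z))
        + (P.g a₅ (P.φ z) + P.g a₁ (P.φ (P.φ z)))
        - (P.g a₆ (P.φ z) + P.g a₂ (P.φ (P.φ z))) := by
  simp only [map_sub, map_add, LinearMap.sub_apply, LinearMap.add_apply, P.g_phi_left]
  ring

namespace AlmostParacontactMetricStructure

variable {n : ℕ} {M : Type*} [TopologicalSpace M]
  [ChartedSpace (EuclideanSpace ℝ (Fin (2 * n + 1))) M] [IsManifold (𝓡 (2 * n + 1)) ∞ M]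
  (S : AlmostParacontactMetricStructure n M) {p : M}
  {X Y Z : Π q : M, TangentSpace (𝓡 (2 * n + 1)) q}

theorem mdifferentiableAt_phi (hY : VectorFieldDifferentiableAt Y p) :
    VectorFieldDifferentiableAt (fun q ↦ S.φ q (Y q)) p :=
  PseudoRiemannianMetric.mdifferentiableAt_end_apply S.contMDiff_phi hY

theorem mdifferentiableAt_xi : VectorFieldDifferentiableAt S.ξ p :=
  S.contMDiff_xi.mdifferentiableAt (by simp)

theorem val_xi (x : TangentSpace (𝓡 (2 * n + 1)) p) : S.g.val p x (S.ξ p) = S.η p x :=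
  (S.atPoint p).g_xi x

theorem val_phi_left (x y : TangentSpace (𝓡 (2 * n + 1)) p) :
    S.g.val p (S.φ p x) y = -S.g.val p x (S.φ p y) :=
  (S.atPoint p).g_phi_left x y

theorem eta_phi (x : TangentSpace (𝓡 (2 * n + 1)) p) : S.η p (S.φ p x) = 0 :=
  (S.atPoint p).eta_phi x

theorem eta_eq_val : (fun q ↦ S.η q (Y q)) = fun q ↦ S.g.val q (Y q) (S.ξ q) :=
  funext fun _ ↦ (S.val_xi _).symm

/-- `F(x, Y, z) = g(∇_x φY, z) + g(∇_x Y, φz)`. -/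
theorem F_apply (hY : VectorFieldDifferentiableAt Y p) (x z : TangentSpace (𝓡 (2 * n + 1)) p) :
    S.F p x (Y p) z = S.g.val p (S.g.leviCivita (fun q ↦ S.φ q (Y q)) p x) z
      + S.g.val p (S.g.leviCivita Y p x) (S.φ p z) := by
  change S.g.val p (S.g.nablaEnd S.φ S.contMDiff_phi p (Y p) x) z = _
  rw [S.g.nablaEnd_apply S.contMDiff_phi hY, map_sub, sub_apply, S.val_phi_left]
  ring

/-- `F(x, ξ, z) = g(∇_x ξ, φz)`. -/
theorem F_xi (x z : TangentSpace (𝓡 (2 * n + 1)) p) :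
    S.F p x (S.ξ p) z = S.g.val p (S.g.leviCivita S.ξ p x) (S.φ p z) := by
  have h : (fun q ↦ S.φ q (S.ξ q)) = 0 := funext S.phi_xi
  rw [S.F_apply S.mdifferentiableAt_xi, h, S.g.leviCivita.zero]
  simp

theorem eta_leviCivita_xi (x : TangentSpace (𝓡 (2 * n + 1)) p) :
    S.η p (S.g.leviCivita S.ξ p x) = 0 := by
  obtain ⟨X, hX, rfl⟩ := exists_vectorFieldDifferentiableAt_apply_eq x
  have h := S.g.leviCivita_metric hX S.mdifferentiableAt_xi S.mdifferentiableAt_xi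
  have h1 : (fun q ↦ S.g.val q (S.ξ q) (S.ξ q)) = fun _ ↦ (1 : ℝ) :=
    funext fun q ↦ (S.val_xi _).trans (S.eta_xi q)
  rw [h1, mvfderiv_const, S.g.symm p (S.ξ p), S.val_xi] at h
  change 0 = _ at h
  linarith

theorem F_swap (x y z : TangentSpace (𝓡 (2 * n + 1)) p) : S.F p x y z = -S.F p x z y := by
  obtain ⟨X, hX, rfl⟩ := exists_vectorFieldDifferentiableAt_apply_eq x
  obtain ⟨Y, hY, rfl⟩ := exists_vectorFieldDifferentiableAt_apply_eq y
  obtain ⟨Z, hZ, rfl⟩ := exists_vectorFieldDifferentiableAt_apply_eq z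
  have h1 := S.g.leviCivita_metric hX (S.mdifferentiableAt_phi hY) hZ
  have h2 := S.g.leviCivita_metric hX hY (S.mdifferentiableAt_phi hZ)
  have h3 : (fun q ↦ S.g.val q (S.φ q (Y q)) (Z q)) =
      -(fun q ↦ S.g.val q (Y q) (S.φ q (Z q))) := funext fun q ↦ S.val_phi_left _ _
  have h4 : mvfderiv (𝓡 (2 * n + 1)) (-(fun q ↦ S.g.val q (Y q) (S.φ q (Z q)))) p (X p) =
      -mvfderiv (𝓡 (2 * n + 1)) (fun q ↦ S.g.val q (Y q) (S.φ q (Z q))) p (X p) := by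
    rw [mvfderiv_neg]
    rfl
  rw [h3, h4, h2, S.g.symm p (S.φ p (Y p)), S.g.symm p (Y p)] at h1
  rw [S.F_apply hY, S.F_apply hZ]
  linarith

theorem F_mem_structureTensors (p : M) : S.F p ∈ (S.atPoint p).structureTensors := by
  refine ⟨S.F_swap, fun x y z ↦ ?_⟩
  obtain ⟨Y, hY, rfl⟩ := exists_vectorFieldDifferentiableAt_apply_eq y
  change S.F p x (Y p) z = S.F p x (S.φ p (Y p)) (S.φ p z) - S.η p (Y p) * S.F p x z (S.ξ p)
    + S.η p z * S.F p x (Y p) (S.ξ p)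
  have hf : MDifferentiableAt (𝓡 (2 * n + 1)) 𝓘(ℝ) (fun q ↦ S.η q (Y q)) p := by
    rw [S.eta_eq_val]
    exact S.g.mdifferentiableAt_apply hY S.mdifferentiableAt_xi
  have hφ := S.mdifferentiableAt_phi hY
  have hφφ := S.mdifferentiableAt_phi hφ
  have hdec : Y = (fun q ↦ S.φ q (S.φ q (Y q))) + (fun q ↦ S.η q (Y q)) • S.ξ := by
    ext1 q
    simp [S.phi_phi]
  have hcov := S.g.leviCivita.isCovariantDerivativeOnUniv
  have h1 : S.g.leviCivita Y p = S.g.leviCivita (fun q ↦ S.φ q (S.φ q (Y q))) p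
      + S.g.leviCivita ((fun q ↦ S.η q (Y q)) • S.ξ) p := by
    conv_lhs => rw [hdec]
    exact hcov.add hφφ (hf.smul_section S.mdifferentiableAt_xi)
  rw [hcov.leibniz S.mdifferentiableAt_xi hf] at h1
  have h2 := congrArg (fun A ↦ S.g.val p (A x) (S.φ p z)) h1
  have h3 : S.g.val p (S.ξ p) (S.φ p z) = 0 := by rw [S.g.symm, S.val_xi, S.eta_phi]
  simp [h3] at h2
  have h4 := S.F_swap x z (S.ξ p)
  rw [S.F_xi] at h4
  rw [h4, S.F_apply hY, S.F_apply hφ, S.F_apply hY, S.phi_phi, S.phi_xi, map_zero, map_sub, map_smul,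
    smul_eq_mul, h2]
  ring

theorem F_phi_xi (x y : TangentSpace (𝓡 (2 * n + 1)) p) :
    S.F p x (S.φ p y) (S.ξ p) = -S.g.val p (S.g.leviCivita S.ξ p x) y := by
  rw [S.F_swap, S.F_xi, S.phi_phi, map_sub, map_smul, S.val_xi, S.eta_leviCivita_xi]
  simp

theorem two_mul_dEta (hX : VectorFieldDifferentiableAt X p)
    (hY : VectorFieldDifferentiableAt Y p) : 2 * S.dEta X Y p =
      S.F p (Y p) (S.φ p (X p)) (S.ξ p) - S.F p (X p) (S.φ p (Y p)) (S.ξ p) := by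
  have hξ := S.mdifferentiableAt_xi (p := p)
  rw [S.F_phi_xi, S.F_phi_xi, dEta, S.eta_eq_val, S.eta_eq_val, S.g.leviCivita_metric hX hY hξ,
    S.g.leviCivita_metric hY hX hξ, ← S.g.leviCivita_torsion hX hY, map_sub, S.val_xi, S.val_xi,
    S.g.symm p (Y p), S.g.symm p (X p)]
  ring

theorem val_nijenhuis (hX : VectorFieldDifferentiableAt X p)
    (hY : VectorFieldDifferentiableAt Y p) (z : TangentSpace (𝓡 (2 * n + 1)) p) :
    S.g.val p (S.nijenhuis X Y p) z =
      S.F p (S.φ p (X p)) (Y p) z - S.F p (S.φ p (Y p)) (X p) z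
        + S.F p (X p) (Y p) (S.φ p z) - S.F p (Y p) (X p) (S.φ p z) := by
  have hφX := S.mdifferentiableAt_phi hX
  have hφY := S.mdifferentiableAt_phi hY
  rw [S.F_apply hY, S.F_apply hX, S.F_apply hY, S.F_apply hX, nijenhuis,
    ← S.g.leviCivita_torsion hX hY, ← S.g.leviCivita_torsion hφX hφY,
    ← S.g.leviCivita_torsion hφX hY, ← S.g.leviCivita_torsion hX hφY]
  generalize S.g.leviCivita Y p (X p) = a₁
  generalize S.g.leviCivita X p (Y p) = a₂
  generalize S.g.leviCivita Y p (S.φ p (X p)) = a₃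
  generalize S.g.leviCivita X p (S.φ p (Y p)) = a₄
  generalize S.g.leviCivita (fun q ↦ S.φ q (Y q)) p (X p) = a₅
  generalize S.g.leviCivita (fun q ↦ S.φ q (X q)) p (Y p) = a₆
  generalize S.g.leviCivita (fun q ↦ S.φ q (Y q)) p (S.φ p (X p)) = a₇
  generalize S.g.leviCivita (fun q ↦ S.φ q (X q)) p (S.φ p (Y p)) = a₈
  exact (S.atPoint p).g_phi_sub_combination a₁ a₂ a₃ a₄ a₅ a₆ a₇ a₈ z

/-- The tensor of normality in terms of `F`. -/
theorem val_nijenhuis_sub (hX : VectorFieldDifferentiableAt X p)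
    (hY : VectorFieldDifferentiableAt Y p) (z : TangentSpace (𝓡 (2 * n + 1)) p) :
    S.g.val p (S.nijenhuis X Y p - (2 * S.dEta X Y p) • S.ξ p) z =
      (S.atPoint p).normalityTensor (S.F p) (X p) (Y p) z := by
  have hz : S.g.val p (S.ξ p) z = S.η p z := by rw [S.g.symm, S.val_xi]
  rw [map_sub, map_smul, sub_apply, smul_apply, S.val_nijenhuis hX hY, S.two_mul_dEta hX hY, hz]
  change _ = S.F p (S.φ p (X p)) (Y p) z - S.F p (S.φ p (Y p)) (X p) z
    + S.F p (X p) (Y p) (S.φ p z) - S.F p (Y p) (X p) (S.φ p z)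
    + S.η p z * (S.F p (X p) (S.φ p (Y p)) (S.ξ p) - S.F p (Y p) (S.φ p (X p)) (S.ξ p))
  rw [smul_eq_mul]
  ring

theorem isNormal_iff [T2Space M] :
    S.IsNormal ↔ ∀ p, S.F p ∈ (S.atPoint p).normalTensors := by
  have hmd : ∀ (X : Cₛ^∞⟮𝓡 (2 * n + 1); EuclideanSpace ℝ (Fin (2 * n + 1)),
      (TangentSpace (𝓡 (2 * n + 1)) : M → Type _)⟯) (p : M), VectorFieldDifferentiableAt (fun q ↦ X q) p :=
    fun X _ ↦ X.mdifferentiableAt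
  constructor
  · intro hN p
    refine AlmostParacontactMetricSpace.mem_normalTensors_of_normalityTensor
      (S.F_mem_structureTensors p) fun x y z ↦ ?_
    obtain ⟨X, rfl⟩ := exists_contMDiffSection_apply_eq x
    obtain ⟨Y, rfl⟩ := exists_contMDiffSection_apply_eq y
    rw [← S.val_nijenhuis_sub (hmd X p) (hmd Y p), hN X Y p]
    simp
  · intro hF X Y p
    refine S.g.nondegenerate p _ fun z ↦ ?_
    rw [S.val_nijenhuis_sub (hmd X p) (hmd Y p)]
    exact AlmostParacontactMetricSpace.normalityTensor_eq_zero (hF p) _ _ _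

end AlmostParacontactMetricStructure

/-- An almost paracontact metric manifold is normal if and only if it belongs to one of the classes
`𝔾₁, 𝔾₂, 𝔾₅, 𝔾₆, 𝔾₇, 𝔾₈` or to a direct sum of some of them. -/
theorem theorem2p2 {n : ℕ} (hn : 1 ≤ n) {M : Type*} [TopologicalSpace M] [T2Space M]
    [ChartedSpace (EuclideanSpace ℝ (Fin (2 * n + 1))) M] [IsManifold (𝓡 (2 * n + 1)) ∞ M]
    (S : AlmostParacontactMetricStructure n M) :
    S.IsNormal ↔ ∃ s : Set BasicClass, s.Nonempty ∧ S.InDirectSum s := by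
  rw [S.isNormal_iff]
  constructor
  · intro h
    refine ⟨Set.univ, ⟨.G₁, trivial⟩, fun p ↦ ⟨?_, ?_⟩⟩
    · exact (BasicClass.iSupIndep_subspace (S.atPoint p)).comp Subtype.val_injective
    · refine (BasicClass.normalTensors_le_iSup (S.atPoint p) (by omega)).trans ?_ (h p)
      exact iSup_le fun i ↦ le_iSup
        (fun i : (Set.univ : Set BasicClass) ↦ i.1.subspace (S.atPoint p)) ⟨i, trivial⟩
  · rintro ⟨s, -, hs⟩ p
    exact iSup_le (fun i : s ↦ BasicClass.subspace_le_normalTensors (S.atPoint p) i.1) (hs p).2
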